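/- A fundamental discriminant is an integer $d$ such that either $d\equiv 1 \pmod 4$ and $d$ is square-free (so $d=1$ is allowed), or $d=4m$ with $m$ square-free and $m\equiv 2$ or $3\pmod 4$. For a nonzero integer $d\equiv 0,1\pmod 4$ let $\chi_d(n)=\left(\frac{d}{n}\right)$ (Kronecker symbol), a Dirichlet character modulo $|d|$. For $j=1,2$ let $z_j\equiv 1\pmod 4$ be a positive square-free integer, $z_j^*=-4z_j$, $K_j=\mathbb{Q}(\sqrt{z_j^*})$, and let $f_j,g_j$ be fundamental discriminants with $f_jg_j=z_j^*$. Let $\chi_j=\chi_{f_j,g_j}$ be the genus character of $K_j$, that is, the completely multiplicative function on nonzero ideals of $\mathcal{O}_{K_j}$ given on prime ideals by $\chi_{f_j,g_j}(\mathfrak p)=\chi_{f_j}(\mathcal N\mathfrak p)$ if $\mathfrak p\nmid f_j$ and $\chi_{f_j,g_j}(\mathfrak p)=\chi_{g_j}(\mathcal N\mathfrak p)$ if $\mathfrak p\nmid g_j$. Put $a_j(n,\chi_j)=\sum_{\mathcal N\mathfrak a=n}\chi_j(\mathfrak a)$, the sum over ideals $\mathfrak a$ of $\mathcal{O}_{K_j}$.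 Then the Dirichlet series $\sum_{n\ge1}a_1(n,\chi_1)a_2(n,\chi_2)n^{-s}$ converges absolutely for $\mathrm{Re}(s)>1$ and has a meromorphic continuation $\mathcal A(s,\chi_1,\chi_2)$ to the half plane $\mathrm{Re}(s)>1/2$. Moreover, $\mathcal A(s,\chi_1,\chi_2)$ has a pole at $s=1$ if and only if there is a fundamental discriminant $d\mid(z_1^*,z_2^*)$ such that, as meromorphic functions on $\mathrm{Re}(s)>1/2$, $$\mathcal A(s,\chi_1,\chi_2)=\frac{\zeta^{(d)}(s)\,L(s,\chi_{z_1^*})\,L(s,\chi_{z_2^*})\,L(s,\chi_{z_1^*/d}\chi_{z_2^*/d})}{L(2s,\chi_{z_1^*}\chi_{z_2^*})},$$ where $\zeta^{(d)}(s)=\zeta(s)\prod_{p\mid d}(1-p^{-s})$ and the $L(s,\cdot)$ are the meromorphically continued Dirichlet $L$-functions. -/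

import Mathlib

open scoped NumberTheorySymbols

/-- `d` is a discriminant: a nonzero integer congruent to `0` or `1` modulo `4`. -/
def IsDiscriminant (d : ℤ) : Prop :=
  d ≠ 0 ∧ (d % 4 = 0 ∨ d % 4 = 1)

/-- `d` is a fundamental discriminant; `1` is included (it belongs to the trivial character). -/
def IsFundamentalDiscriminant (d : ℤ) : Prop :=
  (d % 4 = 1 ∧ Squarefree d) ∨
    (d % 4 = 0 ∧ Squarefree (d / 4) ∧ (d / 4 % 4 = 2 ∨ d / 4 % 4 = 3))

/-- The Kronecker symbol `(d / n)` for `n ≥ 0`. With `n = 2 ^ k * m` and `m` odd it is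
`(d / 2) ^ k * (d / m)`, where `(d / 2)` is `0` for even `d`, `1` for `d ≡ ±1 (mod 8)` and `-1` for
`d ≡ ±3 (mod 8)`, and `(d / m)` is the Jacobi symbol. -/
def kroneckerSym (d : ℤ) (n : ℕ) : ℤ :=
  if n = 0 then (if d.natAbs = 1 then 1 else 0)
  else ZMod.χ₈ (d : ZMod 8) ^ n.factorization 2 * J(d | n / 2 ^ n.factorization 2)

theorem kroneckerSym_of_odd {d : ℤ} {n : ℕ} (hn : n % 2 = 1) : kroneckerSym d n = J(d | n) := by
  have h0 : n ≠ 0 := by omega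
  have h2 : n.factorization 2 = 0 := Nat.factorization_eq_zero_of_not_dvd (by omega)
  simp [kroneckerSym, h0, h2]

theorem kroneckerSym_of_mod_four_eq_zero {d : ℤ} (hd : d % 4 = 0) (n : ℕ) :
    kroneckerSym d n = if n % 2 = 1 then J(d | n) else 0 := by
  split_ifs with hn
  · exact kroneckerSym_of_odd hn
  · unfold kroneckerSym
    split_ifs with h0 h1
    · omega
    · rfl
    · have h2 : n.factorization 2 ≠ 0 :=
        (Nat.Prime.factorization_pos_of_dvd Nat.prime_two h0 (by omega)).ne'
      have h8 : ZMod.χ₈ (d : ZMod 8) = 0 := by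
        rw [ZMod.χ₈_int_eq_if_mod_eight, if_pos (by omega)]
      rw [h8, zero_pow h2, zero_mul]

theorem kroneckerSym_of_mod_four_eq_one {d : ℤ} (hd : d % 4 = 1) (n : ℕ) :
    kroneckerSym d n = J(n | d.natAbs) := by
  have hodd : Odd d.natAbs := Nat.odd_iff.mpr (by omega)
  have key : ∀ m : ℕ, Odd m → J(d | m) = J(m | d.natAbs) := by
    intro m hm
    rcases Int.natAbs_eq d with h | h
    · conv_lhs => rw [h]
      exact jacobiSym.quadratic_reciprocity_one_mod_four (by omega) hm
    · conv_lhs => rw [h, jacobiSym.neg _ hm]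
      have h3 : d.natAbs % 4 = 3 := by omega
      rcases Nat.odd_mod_four_iff.mp (Nat.odd_iff.mp hm) with h1 | h1
      · rw [ZMod.χ₄_nat_one_mod_four h1, one_mul,
          jacobiSym.quadratic_reciprocity_one_mod_four' hodd h1]
      · rw [ZMod.χ₄_nat_three_mod_four h1, jacobiSym.quadratic_reciprocity_three_mod_four h3 h1]
        ring
  by_cases h0 : n = 0
  · subst h0
    unfold kroneckerSym
    by_cases h1 : d.natAbs = 1
    · simp [h1]
    · have : 1 < d.natAbs := by omega
      simp [h1, jacobiSym.zero_left this]
  · have hm : Odd (n / 2 ^ n.factorization 2) :=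
      Nat.odd_iff.mpr (by
        have := Nat.not_dvd_ordCompl Nat.prime_two h0
        omega)
    have h8 : ZMod.χ₈ (d : ZMod 8) = J(2 | d.natAbs) := by
      rw [jacobiSym.at_two hodd, ZMod.χ₈_int_eq_if_mod_eight, ZMod.χ₈_nat_eq_if_mod_eight]
      split_ifs <;> omega
    conv_rhs => rw [← Nat.ordProj_mul_ordCompl_eq_self n 2]
    push_cast
    rw [jacobiSym.mul_left, jacobiSym.pow_left, ← h8]
    simp only [kroneckerSym, h0, if_false]
    rw [key _ hm]
    norm_cast

theorem kroneckerSym_mul {d : ℤ} (hd : IsDiscriminant d) (m n : ℕ) :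
    kroneckerSym d (m * n) = kroneckerSym d m * kroneckerSym d n := by
  obtain ⟨hd0, hd | hd⟩ := hd
  · simp only [kroneckerSym_of_mod_four_eq_zero hd]
    rcases Nat.mod_two_eq_zero_or_one m with hm | hm
    · simp [hm, Nat.mul_mod]
    · rcases Nat.mod_two_eq_zero_or_one n with hn | hn
      · simp [hn, Nat.mul_mod]
      · simp [hm, hn, Nat.mul_mod, jacobiSym.mul_right' d (show m ≠ 0 by omega)
          (show n ≠ 0 by omega)]
  · simp only [kroneckerSym_of_mod_four_eq_one hd]
    push_cast
    exact jacobiSym.mul_left _ _ _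

theorem kroneckerSym_mod {d : ℤ} (hd : IsDiscriminant d) (n : ℕ) :
    kroneckerSym d (n % d.natAbs) = kroneckerSym d n := by
  obtain ⟨hd0, hd | hd⟩ := hd
  · simp only [kroneckerSym_of_mod_four_eq_zero hd]
    have h2 : n % d.natAbs % 2 = n % 2 := Nat.mod_mod_of_dvd _ (by omega)
    rw [h2]
    split_ifs with hn
    · rw [← jacobiSym.div_four_left hd hn, ← jacobiSym.div_four_left hd (h2.trans hn),
        jacobiSym.mod_right (d / 4) (Nat.odd_iff.mpr hn),
        show 4 * (d / 4).natAbs = d.natAbs by omega]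
    · rfl
  · simp only [kroneckerSym_of_mod_four_eq_one hd]
    refine jacobiSym.mod_left' ?_
    push_cast
    exact Int.emod_emod_of_dvd _ (by simp)

theorem kroneckerSym_one_right (d : ℤ) : kroneckerSym d 1 = 1 := by
  simp [kroneckerSym]

theorem kroneckerSym_eq_zero {d : ℤ} (hd : IsDiscriminant d) {n : ℕ}
    (hn : ¬ n.Coprime d.natAbs) : kroneckerSym d n = 0 := by
  obtain ⟨hd0, hd | hd⟩ := hd
  · rw [kroneckerSym_of_mod_four_eq_zero hd]
    split_ifs with h
    · refine jacobiSym.eq_zero_iff.mpr ⟨by omega, ?_⟩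
      rwa [Int.gcd_comm]
    · rfl
  · rw [kroneckerSym_of_mod_four_eq_one hd]
    exact jacobiSym.eq_zero_iff.mpr ⟨by omega, hn⟩

open scoped Classical in
/-- The quadratic Dirichlet character `χ_d` modulo `|d|`, `χ_d(n) = (d / n)`, of a discriminant `d`
(the trivial character if `d` is not a discriminant). -/
noncomputable def quadChar (d : ℤ) : DirichletCharacter ℂ d.natAbs :=
  if hd : IsDiscriminant d then
    have : NeZero d.natAbs := ⟨Int.natAbs_ne_zero.mpr hd.1⟩
    { toFun := fun k => (kroneckerSym d k.val : ℂ)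
      map_one' := by
        have h := kroneckerSym_mod hd 1
        rw [ZMod.val_one_eq_one_mod, h, kroneckerSym_one_right, Int.cast_one]
      map_mul' := fun a b => by
        rw [ZMod.val_mul, kroneckerSym_mod hd, kroneckerSym_mul hd, Int.cast_mul]
      map_nonunit' := fun a ha => by
        rw [kroneckerSym_eq_zero hd, Int.cast_zero]
        intro h
        apply ha
        rw [← ZMod.natCast_zmod_val a]
        exact (ZMod.isUnit_iff_coprime _ _).mpr h }
  else 1

theorem quadChar_natCast {d : ℤ} (hd : IsDiscriminant d) (n : ℕ) :
    quadChar d (n : ZMod d.natAbs) = (kroneckerSym d n : ℂ) := by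
  have : NeZero d.natAbs := ⟨Int.natAbs_ne_zero.mpr hd.1⟩
  have h : quadChar d (n : ZMod d.natAbs) =
      (kroneckerSym d (n : ZMod d.natAbs).val : ℂ) := by
    rw [quadChar, dif_pos hd]
    rfl
  rw [h, ZMod.val_natCast, kroneckerSym_mod hd]

open scoped Classical in
/-- The meromorphically continued Dirichlet `L`-function of a Dirichlet character of positive level
(only such levels occur below). -/
noncomputable def dirichletL {N : ℕ} (χ : DirichletCharacter ℂ N) (s : ℂ) : ℂ :=
  if hN : N = 0 then 0
  else
    have : NeZero N := ⟨hN⟩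
    χ.LFunction s

/-- `ζ^{(d)}(s) = ζ(s) * ∏_{p ∣ d} (1 - p^{-s})`. -/
noncomputable def zetaDepleted (d : ℤ) (s : ℂ) : ℂ :=
  riemannZeta s * ∏ p ∈ d.natAbs.primeFactors, (1 - (p : ℂ) ^ (-s))

/-- `K` is the field `ℚ(√D)`. -/
def IsQuadraticFieldOf (K : Type*) [Field K] [NumberField K] (D : ℤ) : Prop :=
  ∃ α : K, α ^ 2 = (D : K) ∧ IntermediateField.adjoin ℚ {α} = ⊤

section GenusCharacter

variable (K : Type*) [Field K] [NumberField K]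

open scoped Classical in
/-- The value of the genus character `χ_{f,g}` at a prime ideal `𝔭`: it is `χ_f(N𝔭)` if `𝔭 ∤ f`, and
`χ_g(N𝔭)` otherwise. -/
noncomputable def genusCharPrime (f g : ℤ) (𝔭 : Ideal (NumberField.RingOfIntegers K)) : ℂ :=
  if 𝔭 ∣ Ideal.span {(f : NumberField.RingOfIntegers K)} then
    (kroneckerSym g (Ideal.absNorm 𝔭) : ℂ)
  else (kroneckerSym f (Ideal.absNorm 𝔭) : ℂ)

/-- The genus character `χ_{f,g}` on nonzero integral ideals: the multiplicative extension of its
values on prime ideals, through the factorization into prime ideals. -/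
noncomputable def genusChar (f g : ℤ) (I : Ideal (NumberField.RingOfIntegers K)) : ℂ :=
  ((UniqueFactorizationMonoid.normalizedFactors I).map (genusCharPrime K f g)).prod

/-- `a(n, χ) = ∑_{N𝔞 = n} χ(𝔞)`, the sum over the integral ideals of norm `n` (used for `n ≥ 1`). -/
noncomputable def idealCoeff (χ : Ideal (NumberField.RingOfIntegers K) → ℂ) (n : ℕ) : ℂ :=
  ∑ᶠ (I : Ideal (NumberField.RingOfIntegers K)) (_ : Ideal.absNorm I = n), χ I

end GenusCharacter

/-- `A` is a meromorphic continuation to the half plane `Re s > 1/2` of the Dirichlet series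
`∑_{n ≥ 1} a(n) n^{-s}`, which converges absolutely for `Re s > 1`. -/
structure IsMeromorphicContinuation (a : ℕ → ℂ) (A : ℂ → ℂ) : Prop where
  meromorphicOn : MeromorphicOn A {s : ℂ | 1 / 2 < s.re}
  hasSum : ∀ s : ℂ, 1 < s.re → LSeriesHasSum a s (A s)

/-- `f` has a pole at `z`. -/
def HasPoleAt (f : ℂ → ℂ) (z : ℂ) : Prop :=
  MeromorphicAt f z ∧ meromorphicOrderAt f z < 0

/-- `z^* = -4z`. -/
def zStar (z : ℕ) : ℤ := -4 * (z : ℤ)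

/-! By Kronecker's factorization the L-function of the genus character χ_{f,g} is L(s, χ_f) L(s,
χ_g), so that a_j is the Dirichlet convolution χ_{f_j} * χ_{g_j} (`idealCoeff_genusChar`). Both
sides are multiplicative, and at powers of p the claim depends only on whether p is inert, ramified
or split. The ring of integers is never computed: with α² = -z, it is enough that it has rank 2 and
that N(α - x) = x² + z.

Ramanujan's identity (`ArithmeticFunction.pmul_mul_eq`) turns the product of the two convolutions
into the four series L(s, χ_{f₁}χ_{f₂}), L(s, χ_{f₁}χ_{g₂}), L(s, χ_{g₁}χ_{f₂}), L(s, χ_{g₁}χ_{g₂})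
divided by L(2s, χ_{z₁*}χ_{z₂*}), for Re s > 1 (`LSeriesHasSum_rankinSelberg`). This quotient is the
continuation. By the identity theorem any other continuation agrees with it off a discrete set;
values at isolated points are arbitrary, hence the equalities along `codiscreteWithin`.

At s = 1 the denominator is a nonzero value at 2, and L-functions of nonprincipal characters are
finite and nonzero. A pole therefore makes one of the four products principal, which for fundamental
discriminants not divisible by 8 forces the two discriminants to coincide
(`eq_of_quadChar_mul_eq_one`). If d is the common value, χ_d² contributes ζ^{(d)}, the mixed
products become χ_{z₁*} and χ_{z₂*}, and the two cofactors are z_j*/d. Conversely, no L-function in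
the numerator vanishes at 1, so the pole of ζ^{(d)} survives. -/

/-! ### Kronecker symbols, and when a product of two quadratic characters is principal -/

theorem IsFundamentalDiscriminant.isDiscriminant {d : ℤ} (hd : IsFundamentalDiscriminant d) :
    IsDiscriminant d := by
  rcases hd with ⟨h, -⟩ | ⟨h, -, h'⟩
  · exact ⟨by omega, Or.inr h⟩
  · exact ⟨by omega, Or.inl h⟩

theorem kroneckerSym_mul_left (f g : ℤ) (n : ℕ) :
    kroneckerSym (f * g) n = kroneckerSym f n * kroneckerSym g n := by
  by_cases hn : n = 0
  · subst hn
    simp only [kroneckerSym, if_true, Int.natAbs_mul, mul_eq_one]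
    split_ifs <;> simp_all
  · simp only [kroneckerSym, hn, if_false, Int.cast_mul, map_mul, mul_pow, jacobiSym.mul_left]
    ring

theorem DirichletCharacter.mul_natCast {R : Type*} [CommRing R] [IsDomain R] {N M : ℕ}
    (χ : DirichletCharacter R N) (ψ : DirichletCharacter R M) (n : ℕ) :
    (χ.mul ψ) (n : ZMod (N.lcm M)) = χ (n : ZMod N) * ψ (n : ZMod M) := by
  by_cases h : n.Coprime (N.lcm M)
  · have h1 := changeLevel_eq_cast_of_dvd χ (Nat.dvd_lcm_left N M) (ZMod.unitOfCoprime n h)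
    have h2 := changeLevel_eq_cast_of_dvd ψ (Nat.dvd_lcm_right N M) (ZMod.unitOfCoprime n h)
    rw [ZMod.coe_unitOfCoprime, ZMod.cast_natCast (Nat.dvd_lcm_left N M)] at h1
    rw [ZMod.coe_unitOfCoprime, ZMod.cast_natCast (Nat.dvd_lcm_right N M)] at h2
    rw [DirichletCharacter.mul, MulChar.mul_apply, h1, h2]
  · rw [MulChar.map_nonunit _ (fun hu => h ((ZMod.isUnit_iff_coprime _ _).mp hu))]
    symm
    by_contra h0
    have hN : n.Coprime N := by
      by_contra hc
      exact h0 (by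
        rw [MulChar.map_nonunit χ (fun hu => hc ((ZMod.isUnit_iff_coprime _ _).mp hu)), zero_mul])
    have hM : n.Coprime M := by
      by_contra hc
      exact h0 (by
        rw [MulChar.map_nonunit ψ (fun hu => hc ((ZMod.isUnit_iff_coprime _ _).mp hu)), mul_zero])
    exact h ((hN.mul_right hM).of_dvd_right (Nat.lcm_dvd_mul N M))

theorem quadChar_mul_natCast {a b : ℤ} (ha : IsDiscriminant a) (hb : IsDiscriminant b) (n : ℕ) :
    ((quadChar a).mul (quadChar b)) (n : ZMod (a.natAbs.lcm b.natAbs)) =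
      (kroneckerSym a n : ℂ) * kroneckerSym b n := by
  rw [DirichletCharacter.mul_natCast, quadChar_natCast ha, quadChar_natCast hb]

/-- Since -m ≡ 1 (mod 4), reciprocity in the form `kroneckerSym_of_mod_four_eq_one` applies to -m;
the sign (-1/n) is the factor χ₄(n). -/
theorem kroneckerSym_four_mul {m : ℤ} (hm : m % 4 = 3) {n : ℕ} (hn : n % 2 = 1) :
    kroneckerSym (4 * m) n = ZMod.χ₄ n * J(n | m.natAbs) := by
  have h4 : J(4 | n) = 1 := by
    have := jacobiSym.sq_one (a := 2) (b := n) (by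
      have := Nat.coprime_two_left.mpr (Nat.odd_iff.mpr hn)
      simpa [Int.gcd, Nat.Coprime] using this)
    rw [← jacobiSym.pow_left] at this
    simpa using this
  have h := kroneckerSym_of_mod_four_eq_one (d := -m) (by omega) n
  rw [kroneckerSym_of_odd hn, Int.natAbs_neg] at h
  rw [kroneckerSym_of_odd hn, jacobiSym.mul_left, h4, one_mul, ← h,
    jacobiSym.neg _ (Nat.odd_iff.mpr hn), ← mul_assoc, ← sq]
  have : ZMod.χ₄ (n : ZMod 4) ^ 2 = 1 := by
    rw [ZMod.χ₄_nat_eq_if_mod_four]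
    split_ifs <;> simp_all
  rw [this, one_mul]

theorem jacobiSym_eq_one_of_modEq {n M : ℕ} (h : n ≡ 1 [MOD M]) : J(n | M) = 1 := by
  rw [← jacobiSym.one_left M]
  exact jacobiSym.mod_left' (by exact_mod_cast (Nat.cast_injective (R := ℤ)).eq_iff.mpr h)

/-- Chinese remainder theorem: n is a nonresidue modulo q and 1 modulo 4(M/q)R, which is prime to q
because M is odd and squarefree and q does not divide R. -/
theorem exists_jacobiSym_eq_neg_one {M R q : ℕ} (hM : Squarefree M) (hMo : Odd M)
    (hq : q.Prime) (hqM : q ∣ M) (hqR : ¬ q ∣ R) :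
    ∃ n : ℕ, n % 4 = 1 ∧ J(n | M) = -1 ∧ J(n | R) = 1 := by
  obtain ⟨M', rfl⟩ := hqM
  have : Fact q.Prime := ⟨hq⟩
  have hq2 : q ≠ 2 := by
    rintro rfl
    exact absurd hMo (by simp)
  have hcop : q.Coprime (4 * (M' * R)) := by
    refine Nat.Coprime.mul_right ?_ (Nat.Coprime.mul_right ?_ ?_)
    · exact Nat.Coprime.pow_right 2 ((Nat.coprime_primes hq Nat.prime_two).mpr hq2)
    · exact Nat.coprime_of_squarefree_mul hM
    · exact (Nat.Prime.coprime_iff_not_dvd hq).mpr hqR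
  obtain ⟨a, ha⟩ := FiniteField.exists_nonsquare (F := ZMod q) (by rwa [ZMod.ringChar_zmod_n])
  obtain ⟨n, hn1, hn2⟩ := Nat.chineseRemainder hcop a.val 1
  have hJq : J(n | q) = -1 := by
    rw [← jacobiSym.legendreSym.to_jacobiSym, legendreSym.eq_neg_one_iff']
    have : (n : ZMod q) = a := by
      rw [(ZMod.natCast_eq_natCast_iff _ _ _).mpr hn1, ZMod.natCast_zmod_val]
    rwa [this]
  have h4 : n ≡ 1 [MOD 4] := hn2.of_mul_right _
  have hM' : n ≡ 1 [MOD M'] := (hn2.of_mul_left 4).of_mul_right _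
  have hR : n ≡ 1 [MOD R] := (hn2.of_mul_left 4).of_mul_left _
  have hq0 : q ≠ 0 := hq.ne_zero
  have hM0 : M' ≠ 0 := by
    rintro rfl
    simp at hMo
  refine ⟨n, h4, ?_, jacobiSym_eq_one_of_modEq hR⟩
  rw [jacobiSym.mul_right' _ hq0 hM0, hJq, jacobiSym_eq_one_of_modEq hM', mul_one]

/-- A fundamental discriminant not divisible by `8` gives the character `n ↦ (n / M)` or
`n ↦ (-1 / n) (n / M)`, where `M` is its odd part. -/
theorem IsFundamentalDiscriminant.exists_odd_part {d : ℤ} (hd : IsFundamentalDiscriminant d)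
    (h8 : ¬ (8 : ℤ) ∣ d) : ∃ M : ℕ, Odd M ∧ Squarefree M ∧
      ((d % 4 = 1 ∧ d.natAbs = M ∧ ∀ n : ℕ, n % 2 = 1 → kroneckerSym d n = J(n | M)) ∨
       (d % 4 = 0 ∧ d.natAbs = 4 * M ∧ d / 4 % 4 = 3 ∧
          ∀ n : ℕ, n % 2 = 1 → kroneckerSym d n = ZMod.χ₄ n * J(n | M))) := by
  rcases hd with ⟨h, hs⟩ | ⟨h, hs, h'⟩
  · exact ⟨d.natAbs, Nat.odd_iff.mpr (by omega), Int.squarefree_natAbs.mpr hs,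
      Or.inl ⟨h, rfl, fun n _ => kroneckerSym_of_mod_four_eq_one h n⟩⟩
  · obtain ⟨m, rfl⟩ : (4 : ℤ) ∣ d := Int.dvd_of_emod_eq_zero h
    have hm : 4 * m / 4 = m := by omega
    rw [hm] at hs h' ⊢
    have hm3 : m % 4 = 3 := by omega
    exact ⟨m.natAbs, Nat.odd_iff.mpr (by omega), Int.squarefree_natAbs.mpr hs,
      Or.inr ⟨h, by omega, hm3, fun n hn => kroneckerSym_four_mul hm3 hn⟩⟩

/-- If the odd parts differ, some prime q divides exactly one of them; n ≡ 1 (mod 4) removes the χ₄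
factors and `exists_jacobiSym_eq_neg_one` applies. If they agree, a and b can differ only by the
factor χ₄, which n ≡ 3 (mod 4) with n ≡ 1 modulo the odd part detects. -/
theorem exists_kroneckerSym_mul_eq_neg_one {a b : ℤ} (ha : IsFundamentalDiscriminant a)
    (hb : IsFundamentalDiscriminant b) (ha8 : ¬ (8 : ℤ) ∣ a) (hb8 : ¬ (8 : ℤ) ∣ b) (hab : a ≠ b) :
    ∃ n : ℕ, kroneckerSym a n * kroneckerSym b n = -1 := by
  obtain ⟨M, hMo, hMs, hM⟩ := ha.exists_odd_part ha8
  obtain ⟨R, hRo, hRs, hR⟩ := hb.exists_odd_part hb8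
  have key : ∀ n : ℕ, n % 4 = 1 →
      kroneckerSym a n = J(n | M) ∧ kroneckerSym b n = J(n | R) := by
    intro n hn
    have h2 : n % 2 = 1 := by omega
    constructor
    · rcases hM with ⟨-, -, h⟩ | ⟨-, -, -, h⟩ <;> simp [h n h2, ZMod.χ₄_nat_one_mod_four hn]
    · rcases hR with ⟨-, -, h⟩ | ⟨-, -, -, h⟩ <;> simp [h n h2, ZMod.χ₄_nat_one_mod_four hn]
  by_cases hMR : M = R
  · subst hMR
    have hcop : Nat.Coprime 4 M :=
      Nat.Coprime.pow_left 2 (Nat.coprime_two_left.mpr hMo)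
    obtain ⟨n, hn1, hn2⟩ := Nat.chineseRemainder hcop 3 1
    have hn3 : n % 4 = 3 := hn1
    have h2 : n % 2 = 1 := by omega
    have hJ := jacobiSym_eq_one_of_modEq hn2
    refine ⟨n, ?_⟩
    rcases hM with ⟨h1, h1', h⟩ | ⟨h1, h1', h1'', h⟩ <;>
    rcases hR with ⟨k1, k1', k⟩ | ⟨k1, k1', k1'', k⟩
    -- Equal absolute values and the same residue 1 modulo 4 fix the sign, so a = b. The last case
    -- is the same with a/4 and b/4, both 3 modulo 4.
    · omega
    · simp [h n h2, k n h2, hJ, ZMod.χ₄_nat_three_mod_four hn3]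
    · simp [h n h2, k n h2, hJ, ZMod.χ₄_nat_three_mod_four hn3]
    · omega
  · have : ∃ q : ℕ, q.Prime ∧ ¬ (q ∣ M ↔ q ∣ R) := by
      by_contra! hc
      exact hMR ((Nat.Squarefree.ext_iff hMs hRs).mpr hc)
    obtain ⟨q, hq, hne⟩ := this
    by_cases hqM : q ∣ M
    · obtain ⟨n, h4, hn1, hn2⟩ := exists_jacobiSym_eq_neg_one (R := R) hMs hMo hq hqM (by tauto)
      exact ⟨n, by rw [(key n h4).1, (key n h4).2, hn1, hn2, mul_one]⟩
    · obtain ⟨n, h4, hn1, hn2⟩ := exists_jacobiSym_eq_neg_one hRs hRo hq (by tauto) hqM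
      exact ⟨n, by rw [(key n h4).1, (key n h4).2, hn1, hn2, one_mul]⟩

theorem eq_of_quadChar_mul_eq_one {a b : ℤ} (ha : IsFundamentalDiscriminant a)
    (hb : IsFundamentalDiscriminant b) (ha8 : ¬ (8 : ℤ) ∣ a) (hb8 : ¬ (8 : ℤ) ∣ b)
    (h : (quadChar a).mul (quadChar b) = 1) : a = b := by
  by_contra hab
  obtain ⟨n, hn⟩ := exists_kroneckerSym_mul_eq_neg_one ha hb ha8 hb8 hab
  have h1 := quadChar_mul_natCast ha.isDiscriminant hb.isDiscriminant n
  rw [h, ← Int.cast_mul, hn] at h1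
  by_cases hu : IsUnit (n : ZMod (a.natAbs.lcm b.natAbs))
  · rw [MulChar.one_apply hu] at h1
    norm_num at h1
  · rw [MulChar.map_nonunit _ hu] at h1
    norm_num at h1

/-! ### Orders of L-functions at s = 1 and the identity theorem -/

section Meromorphic

open Filter Topology

theorem DirichletCharacter.meromorphicOrderAt_LFunction_of_ne {N : ℕ} [NeZero N]
    {χ : DirichletCharacter ℂ N} {s : ℂ} (hs : χ ≠ 1 ∨ s ≠ 1) (hs' : 1 ≤ s.re) :
    meromorphicOrderAt χ.LFunction s = 0 := by
  have han : AnalyticAt ℂ χ.LFunction s := by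
    rcases hs with h | h
    · exact (χ.differentiable_LFunction h).analyticAt s
    · refine DifferentiableOn.analyticAt (s := {1}ᶜ) (fun z hz => ?_) (isOpen_compl_singleton.mem_nhds h)
      exact (χ.differentiableAt_LFunction z (Or.inl hz)).differentiableWithinAt
  rw [← tendsto_ne_zero_iff_meromorphicOrderAt_eq_zero han.meromorphicAt]
  exact ⟨_, χ.LFunction_ne_zero_of_one_le_re hs hs',
    han.continuousAt.tendsto.mono_left nhdsWithin_le_nhds⟩

/-- `LFunctionTrivChar₁` is the entire function extending (s - 1) L(s) and is nonzero at 1, so this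
exhibits the simple pole. -/
theorem DirichletCharacter.LFunction_one_eventuallyEq (N : ℕ) [NeZero N] :
    (1 : DirichletCharacter ℂ N).LFunction =ᶠ[𝓝[≠] 1]
      fun s => (s - 1) ^ (-1 : ℤ) * LFunctionTrivChar₁ N s := by
  filter_upwards [self_mem_nhdsWithin] with s hs
  have h1 : s - 1 ≠ 0 := sub_ne_zero.mpr hs
  rw [LFunctionTrivChar₁, Function.update_of_ne hs]
  simp only [LFunctionTrivChar]
  field_simp

theorem DirichletCharacter.meromorphicAt_LFunction {N : ℕ} [NeZero N]
    (χ : DirichletCharacter ℂ N) (s : ℂ) : MeromorphicAt χ.LFunction s := by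
  by_cases hs : s ≠ 1 ∨ χ ≠ 1
  · refine AnalyticAt.meromorphicAt ?_
    rcases hs with h | h
    · refine DifferentiableOn.analyticAt (s := {1}ᶜ) (fun z hz => ?_) (isOpen_compl_singleton.mem_nhds h)
      exact (χ.differentiableAt_LFunction z (Or.inl hz)).differentiableWithinAt
    · exact (χ.differentiable_LFunction h).analyticAt s
  · push Not at hs
    obtain ⟨rfl, rfl⟩ := hs
    refine MeromorphicAt.congr ?_ (LFunction_one_eventuallyEq N).symm
    refine MeromorphicAt.mul (by fun_prop) ?_
    exact ((differentiable_LFunctionTrivChar₁ N).analyticAt 1).meromorphicAt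

theorem DirichletCharacter.meromorphicOrderAt_LFunction_one (N : ℕ) [NeZero N] :
    meromorphicOrderAt (1 : DirichletCharacter ℂ N).LFunction 1 = (-1 : ℤ) := by
  rw [meromorphicOrderAt_eq_int_iff (meromorphicAt_LFunction _ _)]
  refine ⟨LFunctionTrivChar₁ N, (differentiable_LFunctionTrivChar₁ N).analyticAt 1,
    LFunctionTrivChar₁_apply_one_ne_zero N, ?_⟩
  filter_upwards [LFunction_one_eventuallyEq N] with s hs
  rw [hs, smul_eq_mul]

theorem dirichletL_eq {N : ℕ} [NeZero N] (χ : DirichletCharacter ℂ N) :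
    dirichletL χ = χ.LFunction := by
  funext s
  simp [dirichletL, NeZero.ne N]

theorem meromorphicAt_dirichletL {N : ℕ} (χ : DirichletCharacter ℂ N) (s : ℂ) :
    MeromorphicAt (dirichletL χ) s := by
  rcases eq_or_ne N 0 with rfl | hN
  · have : dirichletL χ = fun _ => 0 := by
      funext s
      simp [dirichletL]
    rw [this]
    fun_prop
  · have : NeZero N := ⟨hN⟩
    rw [dirichletL_eq]
    exact χ.meromorphicAt_LFunction s

theorem meromorphicOrderAt_dirichletL_of_ne {N : ℕ} (hN : N ≠ 0) {χ : DirichletCharacter ℂ N}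
    (hχ : χ ≠ 1) : meromorphicOrderAt (dirichletL χ) 1 = 0 := by
  have : NeZero N := ⟨hN⟩
  rw [dirichletL_eq]
  exact DirichletCharacter.meromorphicOrderAt_LFunction_of_ne (Or.inl hχ) (by simp)

/-- Dirichlet's nonvanishing at 1: principal or not, such a factor cannot cancel a pole. -/
theorem meromorphicOrderAt_dirichletL_le {N : ℕ} (hN : N ≠ 0) (χ : DirichletCharacter ℂ N) :
    meromorphicOrderAt (dirichletL χ) 1 ≤ 0 := by
  by_cases hχ : χ = 1
  · have : NeZero N := ⟨hN⟩
    rw [dirichletL_eq, hχ, DirichletCharacter.meromorphicOrderAt_LFunction_one]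
    exact_mod_cast (by norm_num : (-1 : ℤ) ≤ 0)
  · exact (meromorphicOrderAt_dirichletL_of_ne hN hχ).le

theorem meromorphicAt_dirichletL_two_mul {N : ℕ} (χ : DirichletCharacter ℂ N) (s : ℂ) :
    MeromorphicAt (fun s => dirichletL χ (2 * s)) s :=
  (meromorphicAt_dirichletL χ (2 * s)).comp_analyticAt (f := dirichletL χ) (g := fun s => 2 * s)
    (by fun_prop)

theorem meromorphicOrderAt_dirichletL_two_mul {N : ℕ} (hN : N ≠ 0) (χ : DirichletCharacter ℂ N) :
    meromorphicOrderAt (fun s => dirichletL χ (2 * s)) 1 = 0 := by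
  have : NeZero N := ⟨hN⟩
  have h2 : (2 * 1 : ℂ) ≠ 1 := by norm_num
  have han : ContinuousAt (fun s => dirichletL χ (2 * s)) 1 := by
    rw [dirichletL_eq]
    exact ContinuousAt.comp (g := χ.LFunction) (f := fun s : ℂ => 2 * s)
      (χ.differentiableAt_LFunction _ (Or.inl h2)).continuousAt (by fun_prop)
  rw [← tendsto_ne_zero_iff_meromorphicOrderAt_eq_zero (meromorphicAt_dirichletL_two_mul χ 1)]
  refine ⟨_, ?_, han.tendsto.mono_left nhdsWithin_le_nhds⟩
  rw [dirichletL_eq]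
  exact χ.LFunction_ne_zero_of_one_le_re (Or.inr h2) (by norm_num)

theorem dirichletL_one_level : dirichletL (1 : DirichletCharacter ℂ 1) = riemannZeta := by
  rw [dirichletL_eq, DirichletCharacter.LFunction_modOne_eq]

theorem meromorphicAt_zetaDepleted (d : ℤ) (s : ℂ) : MeromorphicAt (zetaDepleted d) s := by
  have h : AnalyticAt ℂ (fun s : ℂ => ∏ p ∈ d.natAbs.primeFactors, (1 - (p : ℂ) ^ (-s))) s := by
    refine Finset.analyticAt_fun_prod _ fun p hp => ?_
    have hp0 : (p : ℂ) ≠ 0 := by exact_mod_cast (Nat.prime_of_mem_primeFactors hp).ne_zero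
    have : Differentiable ℂ (fun s : ℂ => 1 - (p : ℂ) ^ (-s)) := by
      intro z
      exact (differentiableAt_const _).sub ((differentiableAt_id.neg).const_cpow (Or.inl hp0))
    exact this.analyticAt s
  refine MeromorphicAt.mul ?_ h.meromorphicAt
  rw [← dirichletL_one_level]
  exact meromorphicAt_dirichletL _ _

theorem zetaDepleted_eq_dirichletL {d : ℤ} (hd : d ≠ 0) {s : ℂ} (hs : s ≠ 1) :
    zetaDepleted d s = dirichletL (1 : DirichletCharacter ℂ d.natAbs) s := by
  have : NeZero d.natAbs := ⟨by omega⟩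
  rw [dirichletL_eq]
  have := DirichletCharacter.LFunctionTrivChar_eq_mul_riemannZeta (N := d.natAbs) hs
  rw [DirichletCharacter.LFunctionTrivChar] at this
  rw [this, zetaDepleted, mul_comm]

/-- Away from s = 1 this is the L-function of the principal character modulo |d|, and the order
ignores the value at the point. -/
theorem meromorphicOrderAt_zetaDepleted {d : ℤ} (hd : d ≠ 0) :
    meromorphicOrderAt (zetaDepleted d) 1 = (-1 : ℤ) := by
  have hN : NeZero d.natAbs := ⟨by omega⟩
  rw [← DirichletCharacter.meromorphicOrderAt_LFunction_one d.natAbs, ← dirichletL_eq]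
  refine meromorphicOrderAt_congr ?_
  filter_upwards [self_mem_nhdsWithin] with s hs
  exact zetaDepleted_eq_dirichletL hd hs

/-- The identity theorem for meromorphic functions on `Re s > 1/2` that agree for `Re s > 1`. -/
theorem MeromorphicOn.eventuallyEq_codiscreteWithin_of_half_plane {A B : ℂ → ℂ}
    (hA : MeromorphicOn A {s : ℂ | 1 / 2 < s.re}) (hB : MeromorphicOn B {s : ℂ | 1 / 2 < s.re})
    (h : ∀ s : ℂ, 1 < s.re → A s = B s) :
    A =ᶠ[codiscreteWithin {s : ℂ | 1 / 2 < s.re}] B := by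
  set U : Set ℂ := {s : ℂ | 1 / 2 < s.re}
  have hU : IsPreconnected U := (convex_halfSpace_re_gt (1 / 2)).isPreconnected
  have h2 : (2 : ℂ) ∈ U := by simp [U]; norm_num
  -- A - B vanishes near 2, so it has order ⊤ there; on a preconnected set order ⊤ at one point
  -- implies order ⊤ at every point.
  have htop : meromorphicOrderAt (A - B) 2 = ⊤ := by
    rw [meromorphicOrderAt_eq_top_iff]
    refine Filter.Eventually.filter_mono nhdsWithin_le_nhds ?_
    have : {s : ℂ | 1 < s.re} ∈ 𝓝 (2 : ℂ) :=
      (isOpen_lt continuous_const Complex.continuous_re).mem_nhds (by simp)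
    filter_upwards [this] with s hs
    simp [h s hs]
  rw [EventuallyEq, Filter.Eventually, mem_codiscreteWithin_iff_forall_mem_nhdsNE]
  intro x hx
  have hxtop : meromorphicOrderAt (A - B) x = ⊤ := by
    by_contra hne
    exact (hA.sub hB).meromorphicOrderAt_ne_top_of_isPreconnected hU hx h2 hne htop
  rw [meromorphicOrderAt_eq_top_iff] at hxtop
  filter_upwards [hxtop] with s hs
  exact Or.inl (sub_eq_zero.mp hs)

theorem hasPoleAt_congr {A B : ℂ → ℂ} {U : Set ℂ} {z : ℂ} (hU : IsOpen U) (hz : z ∈ U)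
    (h : A =ᶠ[codiscreteWithin U] B) : HasPoleAt A z ↔ HasPoleAt B z := by
  have h' : A =ᶠ[𝓝[≠] z] B := by
    rw [EventuallyEq, Filter.Eventually, mem_codiscreteWithin_iff_forall_mem_nhdsNE] at h
    filter_upwards [h z hz, nhdsWithin_le_nhds (hU.mem_nhds hz)] with s hs hsU
    rcases hs with hs | hs
    · exact hs
    · exact absurd hsU hs
  unfold HasPoleAt
  rw [meromorphicOrderAt_congr h', MeromorphicAt.meromorphicAt_congr h']

end Meromorphic

/-! ### Bell series and Ramanujan's identity -/

namespace ArithmeticFunction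

open PowerSeries

/-- `F` is completely multiplicative. -/
def IsCompletelyMultiplicative (F : ArithmeticFunction ℂ) : Prop :=
  F 1 = 1 ∧ ∀ m n : ℕ, F (m * n) = F m * F n

namespace IsCompletelyMultiplicative

variable {F G : ArithmeticFunction ℂ}

theorem isMultiplicative (hF : F.IsCompletelyMultiplicative) : F.IsMultiplicative :=
  ⟨hF.1, fun {m n} _ => hF.2 m n⟩

theorem pmul (hF : F.IsCompletelyMultiplicative) (hG : G.IsCompletelyMultiplicative) :
    (F.pmul G).IsCompletelyMultiplicative := by
  refine ⟨by simp [hF.1, hG.1], fun m n => ?_⟩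
  simp only [pmul_apply, hF.2, hG.2]
  ring

theorem map_pow (hF : F.IsCompletelyMultiplicative) (n k : ℕ) : F (n ^ k) = F n ^ k := by
  induction k with
  | zero => simp [hF.1]
  | succ k ih => rw [pow_succ, hF.2, ih, pow_succ]

end IsCompletelyMultiplicative

/-- The formal power series `∑ F(p^k) X^k`. -/
noncomputable def bellSeries (p : ℕ) (F : ArithmeticFunction ℂ) : PowerSeries ℂ :=
  PowerSeries.mk fun k => F (p ^ k)

@[simp]
theorem coeff_bellSeries (p : ℕ) (F : ArithmeticFunction ℂ) (k : ℕ) :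
    coeff k (bellSeries p F) = F (p ^ k) := by
  simp [bellSeries]

theorem bellSeries_mul {p : ℕ} (hp : p.Prime) (F G : ArithmeticFunction ℂ) :
    bellSeries p (F * G) = bellSeries p F * bellSeries p G := by
  ext k
  rw [PowerSeries.coeff_mul, coeff_bellSeries, mul_apply,
    Nat.sum_divisorsAntidiagonal (f := fun i j => F i * G j), Nat.sum_divisors_prime_pow hp,
    Finset.Nat.sum_antidiagonal_eq_sum_range_succ
      (fun i j => coeff i (bellSeries p F) * coeff j (bellSeries p G))]
  refine Finset.sum_congr rfl fun i hi => ?_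
  rw [Nat.pow_div (by simpa [Nat.lt_succ_iff] using hi) hp.pos, coeff_bellSeries, coeff_bellSeries]

theorem IsCompletelyMultiplicative.bellSeries_mul_one_sub {F : ArithmeticFunction ℂ}
    (hF : F.IsCompletelyMultiplicative) (p : ℕ) :
    bellSeries p F * (1 - C (F p) * X) = 1 := by
  ext k
  rw [mul_sub, mul_one, mul_comm (C (F p)), ← mul_assoc, map_sub, PowerSeries.coeff_mul_C]
  cases k with
  | zero => simp [hF.1]
  | succ k => simp [PowerSeries.coeff_succ_mul_X, hF.map_pow, PowerSeries.coeff_one, pow_succ, hF.2]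

theorem eq_of_bellSeries_eq {F G : ArithmeticFunction ℂ} (hF : F.IsMultiplicative)
    (hG : G.IsMultiplicative) (h : ∀ p : ℕ, p.Prime → bellSeries p F = bellSeries p G) :
    F = G := by
  rw [hF.eq_iff_eq_on_prime_powers F G hG]
  intro p k hp
  simpa using congrArg (coeff k) (h p hp)

/-- A linear recurrence of order two, as satisfied by complete symmetric polynomials in two
variables. -/
theorem recurrence_of_mul_eq_one {H : PowerSeries ℂ} {a b : ℂ}
    (h : H * ((1 - C a * X) * (1 - C b * X)) = 1) :
    coeff 0 H = 1 ∧ coeff 1 H = a + b ∧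
      ∀ k, coeff (k + 2) H = (a + b) * coeff (k + 1) H - a * b * coeff k H := by
  have h' : H = 1 + C (a + b) * (X ^ 1 * H) - C (a * b) * (X ^ 2 * H) := by
    rw [map_add, map_mul]
    linear_combination h
  have hk : ∀ k, coeff k H = coeff k (1 : PowerSeries ℂ) +
      (a + b) * (if 1 ≤ k then coeff (k - 1) H else 0) -
      a * b * (if 2 ≤ k then coeff (k - 2) H else 0) := fun k => by
    conv_lhs => rw [h']
    rw [map_sub (coeff k), map_add (coeff k), PowerSeries.coeff_C_mul, PowerSeries.coeff_C_mul,
      PowerSeries.coeff_X_pow_mul', PowerSeries.coeff_X_pow_mul']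
  have h0 : coeff 0 H = 1 := by
    simpa using hk 0
  refine ⟨h0, ?_, fun k => ?_⟩
  · simpa [PowerSeries.coeff_one, -PowerSeries.coeff_zero_eq_constantCoeff, h0] using hk 1
  · simpa [PowerSeries.coeff_one] using hk (k + 2)

/-- The local factor in Ramanujan's identity. -/
theorem mk_mul_eq_one_sub {H H' : PowerSeries ℂ} {a b c d : ℂ}
    (h : H * ((1 - C a * X) * (1 - C b * X)) = 1)
    (h' : H' * ((1 - C c * X) * (1 - C d * X)) = 1) :
    PowerSeries.mk (fun k => coeff k H * coeff k H') *
        ((1 - C (a * c) * X) * (1 - C (a * d) * X) *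
          ((1 - C (b * c) * X) * (1 - C (b * d) * X))) =
      1 - C (a * b * c * d) * X ^ 2 := by
  obtain ⟨h0, h1, h2⟩ := recurrence_of_mul_eq_one h
  obtain ⟨k0, k1, k2⟩ := recurrence_of_mul_eq_one h'
  set U : PowerSeries ℂ := PowerSeries.mk (fun k => coeff k H * coeff k H') with hU
  have hUk : ∀ k, coeff k U = coeff k H * coeff k H' := fun k => by simp [hU]
  -- The quartic is expanded in functions symmetric in a, b and in c, d, with every monomial written
  -- X ^ i * U, so that one coefficient rule handles all terms.
  have hexp : U * ((1 - C (a * c) * X) * (1 - C (a * d) * X) *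
      ((1 - C (b * c) * X) * (1 - C (b * d) * X))) =
      U - C ((a + b) * (c + d)) * (X ^ 1 * U)
        + C (a * b * (c ^ 2 + d ^ 2) + c * d * (a ^ 2 + b ^ 2) + 2 * (a * b * c * d)) * (X ^ 2 * U)
        - C (a * b * c * d * ((a + b) * (c + d))) * (X ^ 3 * U)
        + C ((a * b * c * d) ^ 2) * (X ^ 4 * U) := by
    simp only [map_add, map_mul, map_pow, map_ofNat]
    ring
  rw [hexp]
  ext n
  rw [map_add (coeff n), map_sub (coeff n), map_add (coeff n), map_sub (coeff n)]
  simp only [PowerSeries.coeff_C_mul, PowerSeries.coeff_X_pow_mul', hUk, map_sub (coeff n),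
    PowerSeries.coeff_one, PowerSeries.coeff_X_pow]
  -- Below degree 4 some shifted terms are absent and the initial values enter; from degree 4 on the
  -- two recurrences alone make the coefficient vanish.
  rcases n with _ | _ | _ | _ | n
  · simp [-PowerSeries.coeff_zero_eq_constantCoeff, h0, k0]
  · simp [-PowerSeries.coeff_zero_eq_constantCoeff, h0, k0, h1, k1]
  · simp [-PowerSeries.coeff_zero_eq_constantCoeff, h0, k0, h1, k1, h2, k2]
    ring
  · simp [-PowerSeries.coeff_zero_eq_constantCoeff, h0, k0, h1, k1, h2, k2]
    ring
  · simp [h2, k2]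
    ring

open scoped ArithmeticFunction.Moebius

open scoped Classical in
/-- The function supported on squares with value `μ(m) ψ(m)` at `m ^ 2`. -/
noncomputable def squareMoebius (ψ : ArithmeticFunction ℂ) : ArithmeticFunction ℂ where
  toFun n := if IsSquare n then ψ n.sqrt * μ n.sqrt else 0
  map_zero' := by simp

theorem squareMoebius_sq (ψ : ArithmeticFunction ℂ) (m : ℕ) :
    squareMoebius ψ (m ^ 2) = ψ m * μ m := by
  have h : IsSquare (m ^ 2) := ⟨m, sq m⟩
  simp [squareMoebius, Nat.sqrt_eq', h]

theorem squareMoebius_of_not_isSquare (ψ : ArithmeticFunction ℂ) {n : ℕ} (hn : ¬ IsSquare n) :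
    squareMoebius ψ n = 0 := by
  simp [squareMoebius, hn]

theorem isMultiplicative_squareMoebius {ψ : ArithmeticFunction ℂ}
    (hψ : ψ.IsCompletelyMultiplicative) : (squareMoebius ψ).IsMultiplicative := by
  refine ⟨?_, fun {m n} hmn => ?_⟩
  · have := squareMoebius_sq ψ 1
    simpa [hψ.1] using this
  · by_cases h : IsSquare (m * n)
    · obtain ⟨c, hc⟩ := h
      rw [← sq] at hc
      -- Coprime factors of a square are themselves squares.
      obtain ⟨a, rfl⟩ := exists_eq_pow_of_mul_eq_pow (Nat.isUnit_iff.mpr hmn) hc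
      obtain ⟨b, rfl⟩ := exists_eq_pow_of_mul_eq_pow (Nat.isUnit_iff.mpr hmn.symm) ((mul_comm _ _).trans hc)
      have hab : Nat.Coprime a b := by
        simpa using hmn
      rw [← mul_pow, squareMoebius_sq, squareMoebius_sq, squareMoebius_sq, hψ.2,
        isMultiplicative_moebius.2 hab]
      push_cast
      ring
    · rw [squareMoebius_of_not_isSquare ψ h]
      by_cases hm : IsSquare m
      · have hn : ¬ IsSquare n := fun hn => h (hm.mul hn)
        rw [squareMoebius_of_not_isSquare ψ hn, mul_zero]
      · rw [squareMoebius_of_not_isSquare ψ hm, zero_mul]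

theorem bellSeries_squareMoebius {ψ : ArithmeticFunction ℂ} (hψ : ψ.IsCompletelyMultiplicative)
    {p : ℕ} (hp : p.Prime) : bellSeries p (squareMoebius ψ) = 1 - C (ψ p) * X ^ 2 := by
  ext k
  rw [coeff_bellSeries, map_sub, PowerSeries.coeff_C_mul, PowerSeries.coeff_X_pow,
    PowerSeries.coeff_one]
  rcases Nat.even_or_odd' k with ⟨j, rfl | rfl⟩
  · rw [mul_comm 2 j, pow_mul, squareMoebius_sq, hψ.map_pow]
    rcases j with _ | _ | j
    · simp
    · simp [moebius_apply_prime hp]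
    · have : μ (p ^ (j + 1 + 1)) = 0 := by
        rw [moebius_apply_prime_pow hp (by omega), if_neg (by omega)]
      rw [this]
      simp
  · have hns : ¬ IsSquare (p ^ (2 * j + 1)) := by
      rintro ⟨c, hc⟩
      have := congrArg (fun n => n.factorization p) hc
      have hc0 : c ≠ 0 := by
        rintro rfl
        exact (pow_pos hp.pos _).ne' hc
      simp only [Nat.factorization_pow, Nat.factorization_mul hc0 hc0, Finsupp.smul_apply,
        Finsupp.add_apply, hp.factorization_self, smul_eq_mul] at this
      omega
    rw [squareMoebius_of_not_isSquare ψ hns, if_neg (by omega), if_neg (by omega)]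
    simp

/-- Ramanujan's identity for the product of two convolutions of completely multiplicative
functions. -/
theorem pmul_mul_eq {α β γ δ : ArithmeticFunction ℂ} (hα : α.IsCompletelyMultiplicative)
    (hβ : β.IsCompletelyMultiplicative) (hγ : γ.IsCompletelyMultiplicative)
    (hδ : δ.IsCompletelyMultiplicative) :
    (α * β).pmul (γ * δ) = α.pmul γ * α.pmul δ * (β.pmul γ * β.pmul δ) *
      squareMoebius ((α.pmul β).pmul (γ.pmul δ)) := by
  have hψ := (hα.pmul hβ).pmul (hγ.pmul hδ)
  refine eq_of_bellSeries_eq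
    ((hα.isMultiplicative.mul hβ.isMultiplicative).pmul
      (hγ.isMultiplicative.mul hδ.isMultiplicative))
    ((((hα.pmul hγ).isMultiplicative.mul (hα.pmul hδ).isMultiplicative).mul
      ((hβ.pmul hγ).isMultiplicative.mul (hβ.pmul hδ).isMultiplicative)).mul
      (isMultiplicative_squareMoebius hψ)) fun p hp => ?_
  -- The Bell series of a convolution is the inverse of two linear factors, being a product of two
  -- geometric series.
  have e : ∀ {F G : ArithmeticFunction ℂ}, F.IsCompletelyMultiplicative →
      G.IsCompletelyMultiplicative →
      bellSeries p (F * G) * ((1 - C (F p) * X) * (1 - C (G p) * X)) = 1 := by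
    intro F G hF hG
    rw [bellSeries_mul hp]
    linear_combination (bellSeries p G * (1 - C (G p) * X)) * hF.bellSeries_mul_one_sub p +
      hG.bellSeries_mul_one_sub p
  have h1 := mk_mul_eq_one_sub (e hα hβ) (e hγ hδ)
  have h2 : PowerSeries.mk (fun k => coeff k (bellSeries p (α * β)) *
      coeff k (bellSeries p (γ * δ))) = bellSeries p ((α * β).pmul (γ * δ)) := by
    ext k
    simp
  rw [h2] at h1
  have h3 := e (hα.pmul hγ) (hα.pmul hδ)
  have h4 := e (hβ.pmul hγ) (hβ.pmul hδ)
  rw [bellSeries_mul hp, bellSeries_mul hp, bellSeries_squareMoebius hψ hp]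
  simp only [pmul_apply] at h3 h4 ⊢
  -- The factor 1 - αβγδ(p) X² becomes the left-hand Bell series times the quartic, and the quartic
  -- cancels the two Bell series by `h3` and `h4`.
  rw [show α p * β p * (γ p * δ p) = α p * β p * γ p * δ p by ring, ← h1]
  linear_combination (-bellSeries p ((α * β).pmul (γ * δ))) *
    (bellSeries p (β.pmul γ * β.pmul δ) *
      ((1 - C (β p * γ p) * X) * (1 - C (β p * δ p) * X)) * h3 + h4)

/-- Reindexing along m ↦ m², with (m²)^s = m^{2s}; this is where the argument 2s of the denominator
comes from. -/
theorem LSeriesHasSum_squareMoebius {ψ : ArithmeticFunction ℂ} {s c : ℂ}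
    (h : LSeriesHasSum (fun n => ψ n * μ n) (2 * s) c) : LSeriesHasSum (squareMoebius ψ) s c := by
  have hinj : Function.Injective fun m : ℕ => m ^ 2 := Nat.pow_left_injective two_ne_zero
  unfold LSeriesHasSum at h ⊢
  rw [← hinj.hasSum_iff]
  · convert h using 1
    funext m
    rcases eq_or_ne m 0 with rfl | hm
    · simp
    · have hpow : ((m ^ 2 : ℕ) : ℂ) ^ s = (m : ℂ) ^ (2 * s) := by
        rw [two_mul, Complex.cpow_add _ _ (by exact_mod_cast hm), sq, Nat.cast_mul,
          Complex.natCast_mul_natCast_cpow]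
      simp only [Function.comp_apply]
      rw [LSeries.term_of_ne_zero (pow_ne_zero 2 hm), LSeries.term_of_ne_zero hm,
        squareMoebius_sq, hpow]
  · intro n hn
    have : ¬ IsSquare n := by
      rintro ⟨c, rfl⟩
      exact hn ⟨c, by simp [sq]⟩
    rcases eq_or_ne n 0 with rfl | hn0
    · simp
    · rw [LSeries.term_of_ne_zero hn0, squareMoebius_of_not_isSquare ψ this, zero_div]

end ArithmeticFunction

/-! ### Dirichlet series of Kronecker symbols and the Rankin-Selberg product -/

section Kronecker

open ArithmeticFunction

/-- The Kronecker symbol `n ↦ (d / n)` as an arithmetic function. -/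
noncomputable def kroneckerArith (d : ℤ) : ArithmeticFunction ℂ :=
  toArithmeticFunction fun n => (kroneckerSym d n : ℂ)

theorem kroneckerArith_apply (d : ℤ) {n : ℕ} (hn : n ≠ 0) :
    kroneckerArith d n = kroneckerSym d n := by
  simp [kroneckerArith, toArithmeticFunction, hn]

theorem isCompletelyMultiplicative_kroneckerArith {d : ℤ} (hd : IsDiscriminant d) :
    (kroneckerArith d).IsCompletelyMultiplicative := by
  refine ⟨by simp [kroneckerArith_apply, kroneckerSym_one_right], fun m n => ?_⟩
  rcases eq_or_ne m 0 with rfl | hm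
  · simp
  rcases eq_or_ne n 0 with rfl | hn
  · simp
  rw [kroneckerArith_apply d hm, kroneckerArith_apply d hn,
    kroneckerArith_apply d (mul_ne_zero hm hn), kroneckerSym_mul hd, Int.cast_mul]

theorem pmul_kroneckerArith (f g : ℤ) :
    (kroneckerArith f).pmul (kroneckerArith g) = kroneckerArith (f * g) := by
  ext n
  rcases eq_or_ne n 0 with rfl | hn
  · simp
  · simp [kroneckerArith_apply _ hn, kroneckerSym_mul_left]

theorem lcm_natAbs_ne_zero {a b : ℤ} (ha : a ≠ 0) (hb : b ≠ 0) :
    a.natAbs.lcm b.natAbs ≠ 0 :=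
  Nat.lcm_ne_zero (Int.natAbs_ne_zero.mpr ha) (Int.natAbs_ne_zero.mpr hb)

/-- `L(s, χ_a χ_b)`. -/
noncomputable abbrev quadLProd (a b : ℤ) : ℂ → ℂ :=
  dirichletL ((quadChar a).mul (quadChar b))

theorem dirichletL_eq_LSeries {N : ℕ} (hN : N ≠ 0) (χ : DirichletCharacter ℂ N) {s : ℂ}
    (hs : 1 < s.re) : dirichletL χ s = LSeries (fun n => χ n) s := by
  have : NeZero N := ⟨hN⟩
  rw [dirichletL_eq, χ.LFunction_eq_LSeries hs]

theorem LSeriesHasSum_kroneckerArith_mul {a b : ℤ} (ha : IsDiscriminant a) (hb : IsDiscriminant b)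
    {s : ℂ} (hs : 1 < s.re) : LSeriesHasSum (kroneckerArith (a * b)) s (quadLProd a b s) := by
  rw [quadLProd, dirichletL_eq_LSeries (lcm_natAbs_ne_zero ha.1 hb.1) _ hs]
  refine (LSeriesHasSum_congr s _ fun {n} hn => ?_).mpr
    (DirichletCharacter.LSeriesSummable_of_one_lt_re _ hs).LSeriesHasSum
  rw [quadChar_mul_natCast ha hb, kroneckerArith_apply _ hn, kroneckerSym_mul_left, Int.cast_mul]

theorem LSeriesHasSum_kroneckerArith {a : ℤ} (ha : IsDiscriminant a)
    {s : ℂ} (hs : 1 < s.re) : LSeriesHasSum (kroneckerArith a) s (dirichletL (quadChar a) s) := by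
  rw [dirichletL_eq_LSeries (Int.natAbs_ne_zero.mpr ha.1) _ hs]
  refine (LSeriesHasSum_congr s _ fun {n} hn => ?_).mpr
    (DirichletCharacter.LSeriesSummable_of_one_lt_re _ hs).LSeriesHasSum
  rw [quadChar_natCast ha, kroneckerArith_apply _ hn]

open scoped ArithmeticFunction.Moebius in
theorem LSeriesHasSum_kroneckerArith_mul_moebius {a b : ℤ} (ha : IsDiscriminant a)
    (hb : IsDiscriminant b) {s : ℂ} (hs : 1 < s.re) :
    LSeriesHasSum (fun n => kroneckerArith (a * b) n * μ n) s (quadLProd a b s)⁻¹ := by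
  set χ := (quadChar a).mul (quadChar b) with hχ
  have h1 := DirichletCharacter.LSeries.mul_mu_eq_one χ hs
  rw [quadLProd, dirichletL_eq_LSeries (lcm_natAbs_ne_zero ha.1 hb.1) _ hs,
    inv_eq_of_mul_eq_one_right h1]
  refine (LSeriesHasSum_congr s _ fun {n} hn => ?_).mpr
    (χ.LSeriesSummable_mul (ArithmeticFunction.LSeriesSummable_moebius_iff.mpr hs)).LSeriesHasSum
  simp only [Pi.mul_apply]
  rw [hχ, quadChar_mul_natCast ha hb, kroneckerArith_apply _ hn, kroneckerSym_mul_left,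
    Int.cast_mul]

/-- The Rankin-Selberg product `∑ (χ_f * χ_g)(n) (χ_f' * χ_g')(n) n^{-s}`. -/
theorem LSeriesHasSum_rankinSelberg {f g f' g' : ℤ} (hf : IsDiscriminant f)
    (hg : IsDiscriminant g) (hf' : IsDiscriminant f') (hg' : IsDiscriminant g')
    (h : IsDiscriminant (f * g)) (h' : IsDiscriminant (f' * g')) {s : ℂ} (hs : 1 < s.re) :
    LSeriesHasSum (fun n => (kroneckerArith f * kroneckerArith g) n *
        (kroneckerArith f' * kroneckerArith g') n) s
      (quadLProd f f' s * quadLProd f g' s * (quadLProd g f' s * quadLProd g g' s) /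
        quadLProd (f * g) (f' * g') (2 * s)) := by
  have hs2 : 1 < (2 * s).re := by
    simp
    linarith
  have key := pmul_mul_eq (isCompletelyMultiplicative_kroneckerArith hf)
    (isCompletelyMultiplicative_kroneckerArith hg) (isCompletelyMultiplicative_kroneckerArith hf')
    (isCompletelyMultiplicative_kroneckerArith hg')
  simp only [pmul_kroneckerArith] at key
  have hsum := LSeriesHasSum_mul (LSeriesHasSum_mul
    (LSeriesHasSum_mul (LSeriesHasSum_kroneckerArith_mul hf hf' hs)
      (LSeriesHasSum_kroneckerArith_mul hf hg' hs))
    (LSeriesHasSum_mul (LSeriesHasSum_kroneckerArith_mul hg hf' hs)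
      (LSeriesHasSum_kroneckerArith_mul hg hg' hs)))
    (LSeriesHasSum_squareMoebius (LSeriesHasSum_kroneckerArith_mul_moebius h h' hs2))
  rw [← key] at hsum
  rw [div_eq_mul_inv]
  exact hsum

end Kronecker

/-! ### Sums over ideals of given norm: multiplicativity and prime powers -/

section IdealSums

open Ideal

variable {K : Type*} [Field K] [NumberField K]

open scoped NumberField

theorem genusChar_mul (f g : ℤ) {I J : Ideal (𝓞 K)} (hI : I ≠ 0) (hJ : J ≠ 0) :
    genusChar K f g (I * J) = genusChar K f g I * genusChar K f g J := by
  simp [genusChar, UniqueFactorizationMonoid.normalizedFactors_mul hI hJ]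

theorem genusChar_one (f g : ℤ) : genusChar K f g (1 : Ideal (𝓞 K)) = 1 := by
  rw [genusChar, UniqueFactorizationMonoid.normalizedFactors_one, Multiset.map_zero,
    Multiset.prod_zero]

theorem genusChar_pow (f g : ℤ) {I : Ideal (𝓞 K)} (hI : I ≠ 0) (k : ℕ) :
    genusChar K f g (I ^ k) = genusChar K f g I ^ k := by
  induction k with
  | zero => rw [pow_zero, pow_zero, genusChar_one]
  | succ k ih => rw [pow_succ, genusChar_mul f g (pow_ne_zero k hI) hI, ih, pow_succ]

theorem genusChar_of_prime (f g : ℤ) {P : Ideal (𝓞 K)} (hP : Prime P) :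
    genusChar K f g P = genusCharPrime K f g P := by
  simp [genusChar, UniqueFactorizationMonoid.normalizedFactors_irreducible hP.irreducible]

theorem idealCoeff_eq_sum (χ : Ideal (𝓞 K) → ℂ) (n : ℕ) :
    idealCoeff K χ n = ∑ I ∈ (finite_setOfPred_absNorm_eq (S := 𝓞 K) n).toFinset, χ I :=
  finsum_mem_eq_finite_toFinset_sum χ (finite_setOfPred_absNorm_eq n)

theorem ne_zero_of_absNorm_eq {I : Ideal (𝓞 K)} {n : ℕ} (hn : n ≠ 0) (hI : absNorm I = n) :
    I ≠ 0 := by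
  rintro rfl
  simp at hI
  exact hn hI.symm

theorem natCast_mem_of_absNorm_eq {I : Ideal (𝓞 K)} {n : ℕ} (hI : absNorm I = n) : (n : 𝓞 K) ∈ I :=
  hI ▸ absNorm_mem I

/-- A + (m) and A + (n) are the parts of A at m and at n; a Bézout relation um + vn = 1 puts every a
∈ A in their product. -/
theorem sup_span_mul_sup_span {m n : ℕ} (hmn : m.Coprime n) {A : Ideal (𝓞 K)}
    (hA : ((m * n : ℕ) : 𝓞 K) ∈ A) :
    (A ⊔ span {(m : 𝓞 K)}) * (A ⊔ span {(n : 𝓞 K)}) = A := by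
  apply le_antisymm
  · rw [Ideal.sup_mul, Ideal.mul_sup, Ideal.mul_sup]
    refine sup_le (sup_le Ideal.mul_le_left Ideal.mul_le_left)
      (sup_le Ideal.mul_le_right ?_)
    rw [Ideal.span_singleton_mul_span_singleton, Ideal.span_singleton_le_iff_mem]
    exact_mod_cast hA
  · intro a ha
    obtain ⟨u, v, huv⟩ := Int.isCoprime_iff_gcd_eq_one.mpr (by simpa using hmn :
      Int.gcd (m : ℤ) (n : ℤ) = 1)
    have h1 : (u : 𝓞 K) * m + v * n = 1 := by exact_mod_cast congrArg (Int.cast (R := 𝓞 K)) huv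
    have e : a = (u : 𝓞 K) * ((m : 𝓞 K) * a) + v * (a * n) := by
      linear_combination (-a) * h1
    rw [e]
    refine add_mem (Ideal.mul_mem_left _ _ (Ideal.mul_mem_mul ?_ ?_))
      (Ideal.mul_mem_left _ _ (Ideal.mul_mem_mul ?_ ?_))
    · exact Ideal.mem_sup_right (Ideal.mem_span_singleton_self _)
    · exact Ideal.mem_sup_left ha
    · exact Ideal.mem_sup_left ha
    · exact Ideal.mem_sup_right (Ideal.mem_span_singleton_self _)

theorem coprime_absNorm_sup_span {m n : ℕ} (hmn : m.Coprime n) (A : Ideal (𝓞 K)) :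
    (absNorm (A ⊔ span {(m : 𝓞 K)})).Coprime n := by
  have h := absNorm_dvd_absNorm_of_le (le_sup_right : span {(m : 𝓞 K)} ≤ A ⊔ span {(m : 𝓞 K)})
  rw [absNorm_span_natCast] at h
  exact Nat.Coprime.coprime_dvd_left h (hmn.pow_left _)

/-- The norm of A + (m) divides a power of m, hence is prime to n, and symmetrically; since the two
norms multiply to mn, each is determined. -/
theorem absNorm_sup_span {m n : ℕ} (hmn : m.Coprime n) {A : Ideal (𝓞 K)} (hA : absNorm A = m * n) :
    absNorm (A ⊔ span {(m : 𝓞 K)}) = m ∧ absNorm (A ⊔ span {(n : 𝓞 K)}) = n := by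
  have hmul := congrArg absNorm (sup_span_mul_sup_span hmn (natCast_mem_of_absNorm_eq hA))
  rw [map_mul, hA] at hmul
  have h1 := coprime_absNorm_sup_span hmn A
  have h2 := coprime_absNorm_sup_span hmn.symm A
  refine ⟨Nat.dvd_antisymm ?_ ?_, Nat.dvd_antisymm ?_ ?_⟩
  · exact h1.dvd_of_dvd_mul_right (hmul ▸ dvd_mul_right _ _)
  · exact h2.symm.dvd_of_dvd_mul_right (hmul ▸ dvd_mul_right _ _)
  · exact h2.dvd_of_dvd_mul_left (hmul ▸ dvd_mul_left _ _)
  · exact h1.symm.dvd_of_dvd_mul_left (hmul ▸ dvd_mul_left _ _)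

theorem mul_sup_span_eq {m n : ℕ} (hmn : m.Coprime n) {I J : Ideal (𝓞 K)} (hI : absNorm I = m)
    (hJ : absNorm J = n) : I * J ⊔ span {(m : 𝓞 K)} = I := by
  have hmI := natCast_mem_of_absNorm_eq hI
  have hnJ := natCast_mem_of_absNorm_eq hJ
  apply le_antisymm
  · exact sup_le Ideal.mul_le_left ((Ideal.span_singleton_le_iff_mem _).mpr hmI)
  · intro a ha
    obtain ⟨u, v, huv⟩ := Int.isCoprime_iff_gcd_eq_one.mpr (by simpa using hmn :
      Int.gcd (m : ℤ) (n : ℤ) = 1)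
    have h1 : (u : 𝓞 K) * m + v * n = 1 := by exact_mod_cast congrArg (Int.cast (R := 𝓞 K)) huv
    have e : a = (v : 𝓞 K) * (a * n) + (u * a) * m := by
      linear_combination (-a) * h1
    rw [e]
    refine add_mem (Ideal.mem_sup_left (Ideal.mul_mem_left _ _ (Ideal.mul_mem_mul ha hnJ)))
      (Ideal.mem_sup_right (Ideal.mul_mem_left _ _ (Ideal.mem_span_singleton_self _)))

/-- Multiplication is a bijection from pairs of ideals of norms m and n to ideals of norm mn, with
inverse A ↦ (A + (m), A + (n)). -/
theorem idealCoeff_mul_of_coprime {χ : Ideal (𝓞 K) → ℂ}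
    (hχ : ∀ {I J : Ideal (𝓞 K)}, I ≠ 0 → J ≠ 0 → χ (I * J) = χ I * χ J) {m n : ℕ} (hm : m ≠ 0)
    (hn : n ≠ 0) (hmn : m.Coprime n) :
    idealCoeff K χ (m * n) = idealCoeff K χ m * idealCoeff K χ n := by
  simp only [idealCoeff_eq_sum]
  rw [Finset.sum_mul_sum, ← Finset.sum_product']
  symm
  refine Finset.sum_nbij' (fun x => x.1 * x.2)
    (fun A => (A ⊔ span {(m : 𝓞 K)}, A ⊔ span {(n : 𝓞 K)})) ?_ ?_ ?_ ?_ ?_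
  · rintro ⟨I, J⟩ h
    simp only [Finset.mem_product, Set.Finite.mem_toFinset, Set.mem_ofPred_eq] at h ⊢
    rw [map_mul, h.1, h.2]
  · intro A hA
    simp only [Finset.mem_product, Set.Finite.mem_toFinset, Set.mem_ofPred_eq] at hA ⊢
    exact absNorm_sup_span hmn hA
  · rintro ⟨I, J⟩ h
    simp only [Finset.mem_product, Set.Finite.mem_toFinset, Set.mem_ofPred_eq] at h
    refine Prod.ext (mul_sup_span_eq hmn h.1 h.2) ?_
    change I * J ⊔ span {(n : 𝓞 K)} = J
    rw [mul_comm]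
    exact mul_sup_span_eq hmn.symm h.2 h.1
  · intro A hA
    simp only [Set.Finite.mem_toFinset, Set.mem_ofPred_eq] at hA
    exact sup_span_mul_sup_span hmn (natCast_mem_of_absNorm_eq hA)
  · rintro ⟨I, J⟩ h
    simp only [Finset.mem_product, Set.Finite.mem_toFinset, Set.mem_ofPred_eq] at h
    exact (hχ (ne_zero_of_absNorm_eq hm h.1) (ne_zero_of_absNorm_eq hn h.2)).symm

/-- An ideal of norm a positive power of `p` has a prime factor dividing `p`. -/
theorem exists_prime_dvd_of_absNorm_eq_pow {p k : ℕ} (hp : p.Prime) {I : Ideal (𝓞 K)}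
    (hI : absNorm I = p ^ (k + 1)) : ∃ P : Ideal (𝓞 K), Prime P ∧ P ∣ span {(p : 𝓞 K)} ∧ P ∣ I := by
  obtain ⟨P, hPm, hPp, hPI⟩ := exists_isMaximal_dvd_of_dvd_absNorm' hp I
    (hI ▸ dvd_pow_self p (Nat.succ_ne_zero k))
  have hpP : (p : 𝓞 K) ∈ P := by
    have : (p : ℤ) ∈ P.under ℤ := hPp ▸ Ideal.mem_span_singleton_self _
    simpa [Ideal.under] using this
  have hP0 : P ≠ ⊥ := by
    rintro rfl
    exact hp.ne_zero (by exact_mod_cast (Ideal.mem_bot.mp hpP))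
  exact ⟨P, prime_of_isPrime hP0 hPm.isPrime,
    Ideal.dvd_span_singleton.mpr hpP, hPI⟩

/-- If `P` is the only prime factor of `p`, the ideals of `p`-power norm are the powers of `P`. -/
theorem exists_eq_pow_of_absNorm_eq_pow {p : ℕ} (hp : p.Prime) {P : Ideal (𝓞 K)} {e : ℕ}
    (he : e ≠ 0) (hPN : absNorm P = p ^ e)
    (huniq : ∀ Q : Ideal (𝓞 K), Prime Q → Q ∣ span {(p : 𝓞 K)} → Q = P) (k : ℕ) {I : Ideal (𝓞 K)}
    (hI : absNorm I = p ^ k) : ∃ j, e * j = k ∧ I = P ^ j := by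
  induction k using Nat.strong_induction_on generalizing I with
  | _ k ih =>
    rcases k with _ | k
    · refine ⟨0, by simp, ?_⟩
      rw [pow_zero] at hI ⊢
      rw [Ideal.absNorm_eq_one_iff.mp hI, Ideal.one_eq_top]
    · obtain ⟨Q, hQ, hQp, J, rfl⟩ := exists_prime_dvd_of_absNorm_eq_pow hp hI
      obtain rfl := huniq Q hQ hQp
      rw [map_mul, hPN] at hI
      have hek : e ≤ k + 1 := (Nat.pow_dvd_pow_iff_le_right hp.one_lt).mp ⟨_, hI.symm⟩
      have hJ : absNorm J = p ^ (k + 1 - e) := by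
        refine Nat.eq_of_mul_eq_mul_left (pow_pos hp.pos e) ?_
        rw [hI, ← pow_add, Nat.add_sub_cancel' hek]
      obtain ⟨j, hj, rfl⟩ := ih (k + 1 - e) (by omega) hJ
      exact ⟨j + 1, by rw [mul_add, hj]; omega, by rw [pow_succ, mul_comm]⟩

theorem idealCoeff_prime_pow_of_unique {p : ℕ} (hp : p.Prime) {P : Ideal (𝓞 K)} {e : ℕ}
    (he : e ≠ 0) (hPN : absNorm P = p ^ e)
    (huniq : ∀ Q : Ideal (𝓞 K), Prime Q → Q ∣ span {(p : 𝓞 K)} → Q = P) (f g : ℤ) (k : ℕ) :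
    idealCoeff K (genusChar K f g) (p ^ k) =
      if e ∣ k then genusChar K f g P ^ (k / e) else 0 := by
  rw [idealCoeff_eq_sum]
  have hP0 : P ≠ 0 := ne_zero_of_absNorm_eq (pow_ne_zero e hp.ne_zero) hPN
  split_ifs with h
  · obtain ⟨j, rfl⟩ := h
    have : (finite_setOfPred_absNorm_eq (S := 𝓞 K) (p ^ (e * j))).toFinset = {P ^ j} := by
      ext I
      simp only [Set.Finite.mem_toFinset, Set.mem_ofPred_eq, Finset.mem_singleton]
      constructor
      · intro hI
        obtain ⟨i, hi, rfl⟩ := exists_eq_pow_of_absNorm_eq_pow hp he hPN huniq _ hI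
        rw [Nat.eq_of_mul_eq_mul_left (Nat.pos_of_ne_zero he) hi]
      · rintro rfl
        rw [map_pow, hPN, pow_mul]
    rw [this, Finset.sum_singleton, genusChar_pow f g hP0,
      Nat.mul_div_cancel_left _ (Nat.pos_of_ne_zero he)]
  · refine Finset.sum_eq_zero fun I hI => ?_
    simp only [Set.Finite.mem_toFinset, Set.mem_ofPred_eq] at hI
    obtain ⟨i, hi, -⟩ := exists_eq_pow_of_absNorm_eq_pow hp he hPN huniq _ hI
    exact absurd ⟨i, hi.symm⟩ h

theorem exists_eq_pow_mul_pow_of_absNorm_eq_pow {p : ℕ} (hp : p.Prime) {P Q : Ideal (𝓞 K)}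
    (hPN : absNorm P = p) (hQN : absNorm Q = p)
    (huniq : ∀ R : Ideal (𝓞 K), Prime R → R ∣ span {(p : 𝓞 K)} → R = P ∨ R = Q) (k : ℕ) {I : Ideal (𝓞 K)}
    (hI : absNorm I = p ^ k) : ∃ i j, i + j = k ∧ I = P ^ i * Q ^ j := by
  induction k generalizing I with
  | zero =>
    refine ⟨0, 0, rfl, ?_⟩
    rw [pow_zero] at hI
    rw [Ideal.absNorm_eq_one_iff.mp hI, pow_zero, pow_zero, one_mul, Ideal.one_eq_top]
  | succ k ih =>
    obtain ⟨R, hR, hRp, J, rfl⟩ := exists_prime_dvd_of_absNorm_eq_pow hp hI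
    have hRN : absNorm R = p := by
      rcases huniq R hR hRp with rfl | rfl <;> assumption
    have hJ : absNorm J = p ^ k := by
      refine Nat.eq_of_mul_eq_mul_left hp.pos ?_
      rw [map_mul, hRN] at hI
      rw [hI, pow_succ']
    obtain ⟨i, j, hij, rfl⟩ := ih hJ
    rcases huniq R hR hRp with rfl | rfl
    · exact ⟨i + 1, j, by omega, by ring⟩
    · exact ⟨i, j + 1, by omega, by ring⟩

theorem not_dvd_of_prime_of_ne {P Q : Ideal (𝓞 K)} (hP : Prime P) (hQ : Prime Q) (hPQ : P ≠ Q) :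
    ¬ P ∣ Q := fun h => hPQ (associated_iff_eq.mp ((hP.dvd_prime_iff_associated hQ).mp h))

theorem pow_mul_pow_injOn {P Q : Ideal (𝓞 K)} (hP : Prime P) (hQ : Prime Q) (hPQ : P ≠ Q) (k : ℕ) :
    Set.InjOn (fun i => P ^ i * Q ^ (k - i)) (Finset.range (k + 1)) := by
  have aux : ∀ i j, i < j → P ^ i * Q ^ (k - i) ≠ P ^ j * Q ^ (k - j) := by
    intro i j hij h
    obtain ⟨d, rfl⟩ := Nat.exists_eq_add_of_lt hij
    rw [show i + d + 1 = i + (d + 1) by ring, pow_add, mul_assoc] at h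
    have h' := mul_left_cancel₀ (pow_ne_zero i hP.ne_zero) h
    have : P ∣ Q ^ (k - i) := by
      rw [h']
      exact Dvd.dvd.mul_right (dvd_pow_self P (Nat.succ_ne_zero d)) _
    exact not_dvd_of_prime_of_ne hP hQ hPQ (hP.dvd_of_dvd_pow this)
  intro i _ j _ h
  rcases lt_trichotomy i j with hlt | heq | hgt
  · exact absurd h (aux i j hlt)
  · exact heq
  · exact absurd h.symm (aux j i hgt)

theorem idealCoeff_prime_pow_of_split {p : ℕ} (hp : p.Prime) {P Q : Ideal (𝓞 K)} (hP : Prime P)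
    (hQ : Prime Q) (hPQ : P ≠ Q) (hPN : absNorm P = p) (hQN : absNorm Q = p)
    (huniq : ∀ R : Ideal (𝓞 K), Prime R → R ∣ span {(p : 𝓞 K)} → R = P ∨ R = Q) (f g : ℤ) (k : ℕ) :
    idealCoeff K (genusChar K f g) (p ^ k) =
      ∑ i ∈ Finset.range (k + 1), genusChar K f g P ^ i * genusChar K f g Q ^ (k - i) := by
  classical
  rw [idealCoeff_eq_sum]
  have : (finite_setOfPred_absNorm_eq (S := 𝓞 K) (p ^ k)).toFinset =
      (Finset.range (k + 1)).image fun i => P ^ i * Q ^ (k - i) := by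
    ext I
    simp only [Set.Finite.mem_toFinset, Set.mem_ofPred_eq, Finset.mem_image, Finset.mem_range]
    constructor
    · intro hI
      obtain ⟨i, j, hij, rfl⟩ := exists_eq_pow_mul_pow_of_absNorm_eq_pow hp hPN hQN huniq _ hI
      exact ⟨i, by omega, by rw [← hij, Nat.add_sub_cancel_left]⟩
    · rintro ⟨i, hi, rfl⟩
      rw [map_mul, map_pow, map_pow, hPN, hQN, ← pow_add, Nat.add_sub_cancel' (by omega)]
  rw [this, Finset.sum_image (pow_mul_pow_injOn hP hQ hPQ k)]
  refine Finset.sum_congr rfl fun i _ => ?_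
  rw [genusChar_mul f g (pow_ne_zero _ hP.ne_zero) (pow_ne_zero _ hQ.ne_zero),
    genusChar_pow f g hP.ne_zero, genusChar_pow f g hQ.ne_zero]

end IdealSums

/-! ### Splitting of rational primes in ℚ(√-z) -/

section QuadraticField

open Ideal Polynomial

variable {K : Type*} [Field K] [NumberField K]

open scoped NumberField

/-- For `γ` with `(γ + x)^2 = -z`, `z > 0`, generating `K`, the degree and the norm of `γ`. -/
theorem finrank_and_norm_of_sq_add_eq {z : ℕ} (hz : 0 < z) {γ : K} {x : ℤ}
    (hγ : (γ + x) ^ 2 = -(z : K)) (hgen : IntermediateField.adjoin ℚ {γ} = ⊤) :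
    Module.finrank ℚ K = 2 ∧ Algebra.norm ℚ γ = (x : ℚ) ^ 2 + z := by
  set q : ℚ[X] := X ^ 2 + C (2 * (x : ℚ)) * X + C ((x : ℚ) ^ 2 + z) with hq
  have hqm : q.Monic := by rw [hq]; monicity!
  have hqd : q.natDegree = 2 := by rw [hq]; compute_degree!
  have hqirr : Irreducible q := by
    rw [hqm.irreducible_iff_roots_eq_zero_of_degree_le_three (by omega) (by omega),
      Multiset.eq_zero_iff_forall_notMem]
    intro r hr
    have hr' := isRoot_of_mem_roots hr
    simp only [hq, IsRoot.def, eval_add, eval_mul, eval_pow, eval_X, eval_C] at hr'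
    have hz' : (0 : ℚ) < z := by exact_mod_cast hz
    -- The polynomial is (X + x)² + z with z > 0, so it has no rational root.
    nlinarith [sq_nonneg (r + x)]
  have hq0 : aeval γ q = 0 := by
    simp only [hq, map_add, map_mul, map_pow, aeval_X, aeval_C, eq_ratCast]
    push_cast
    linear_combination hγ
  have hmin := minpoly.eq_of_irreducible_of_monic hqirr hq0 hqm
  have hint : IsIntegral ℚ γ := ⟨q, hqm, hq0⟩
  have htop : Algebra.adjoin ℚ {γ} = ⊤ :=
    Algebra.adjoin_eq_top_of_intermediateField
      (fun y _ => Algebra.IsAlgebraic.isAlgebraic y) hgen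
  set pb := PowerBasis.ofAdjoinEqTop hint htop with hpb
  have hpbg : pb.gen = γ := PowerBasis.ofAdjoinEqTop_gen hint htop
  have hdim : pb.dim = 2 := by
    rw [← pb.natDegree_minpoly, hpbg, ← hmin, hqd]
  refine ⟨by rw [pb.finrank, hdim], ?_⟩
  have hnorm := Algebra.PowerBasis.norm_gen_eq_coeff_zero_minpoly pb
  rw [hpbg, hdim, ← hmin] at hnorm
  rw [hnorm, coeff_zero_eq_eval_zero]
  simp [hq]

/-- Halving √(-4z) gives the integral element α = √(-z). The rank, α² = -z and the norms of α - x
are all that the analysis of primes needs to know about 𝓞 K. -/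
theorem IsQuadraticFieldOf.exists_sqrt {z : ℕ} (hz : 0 < z)
    (hK : IsQuadraticFieldOf K (zStar z)) :
    Module.finrank ℤ (𝓞 K) = 2 ∧ ∃ α : 𝓞 K, α ^ 2 = -(z : 𝓞 K) ∧
      ∀ x : ℤ, absNorm (span {α - (x : 𝓞 K)}) = (x ^ 2 + z).natAbs := by
  obtain ⟨β, hβ, hgen⟩ := hK
  have h2 : (2 : K) ≠ 0 := two_ne_zero
  have hα : (β / 2) ^ 2 = -(z : K) := by
    rw [div_pow, hβ, zStar]
    push_cast
    ring
  have hint : IsIntegral ℤ (β / 2) := by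
    refine ⟨X ^ 2 + C (z : ℤ), by monicity!, ?_⟩
    simp [hα]
  have key : ∀ x : ℤ, Module.finrank ℚ K = 2 ∧
      Algebra.norm ℚ (β / 2 - (x : K)) = (x : ℚ) ^ 2 + z := by
    intro x
    refine finrank_and_norm_of_sq_add_eq hz (by rw [sub_add_cancel, hα]) ?_
    rw [eq_top_iff, ← hgen, IntermediateField.adjoin_le_iff, Set.singleton_subset_iff]
    set F := IntermediateField.adjoin ℚ {β / 2 - (x : K)}
    have h1 : β / 2 - (x : K) ∈ F := IntermediateField.mem_adjoin_simple_self ℚ _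
    have h3 : β = 2 * (β / 2 - (x : K) + (x : K)) := by field_simp; ring
    rw [h3]
    exact F.mul_mem (ofNat_mem F 2) (F.add_mem h1 (intCast_mem F x))
  obtain ⟨α, hαβ⟩ : ∃ α : 𝓞 K, (α : K) = β / 2 := ⟨⟨β / 2, hint⟩, rfl⟩
  refine ⟨by rw [NumberField.RingOfIntegers.rank, (key 0).1], α, ?_, fun x => ?_⟩
  · apply NumberField.RingOfIntegers.ext
    simpa [hαβ] using hα
  · rw [absNorm_span_singleton]
    congr 1
    have := Algebra.coe_norm_int (α - (x : 𝓞 K))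
    have hx : ((α - (x : 𝓞 K) : 𝓞 K) : K) = β / 2 - (x : K) := by simp [hαβ]
    rw [hx, (key x).2] at this
    exact_mod_cast this

/-- The rational prime `p` is prime in a quadratic field or a product of two primes of norm `p`. -/
theorem prime_span_or_eq_mul (hrank : Module.finrank ℤ (𝓞 K) = 2) {p : ℕ} (hp : p.Prime) :
    Prime (span {(p : 𝓞 K)}) ∨ ∃ P Q : Ideal (𝓞 K), Prime P ∧ Prime Q ∧ absNorm P = p ∧
      absNorm Q = p ∧ span {(p : 𝓞 K)} = P * Q := by
  have hN : absNorm (span {(p : 𝓞 K)}) = p ^ (1 + 1) := by rw [absNorm_span_natCast, hrank]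
  obtain ⟨P, hP, -, Q, hPQ⟩ := exists_prime_dvd_of_absNorm_eq_pow hp hN
  have hmul : absNorm P * absNorm Q = p ^ 2 := by rw [← map_mul, ← hPQ, hN]
  have hP1 : absNorm P ≠ 1 := fun h => hP.not_isUnit (by
    rw [Ideal.isUnit_iff]; exact absNorm_eq_one_iff.mp h)
  obtain ⟨j, hj, hPj⟩ := (Nat.dvd_prime_pow hp).mp ⟨_, hmul.symm⟩
  interval_cases j
  · exact absurd (by simpa using hPj) hP1
  · rw [pow_one] at hPj
    have hQ : absNorm Q = p := by
      rw [hPj, sq] at hmul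
      exact Nat.eq_of_mul_eq_mul_left hp.pos hmul
    refine Or.inr ⟨P, Q, hP, ?_, hPj, hQ, hPQ⟩
    exact prime_of_isPrime (ne_zero_of_absNorm_eq hp.ne_zero hQ)
      (isPrime_of_irreducible_absNorm (by rw [hQ]; exact hp))
  · left
    have hQ : absNorm Q = 1 := by
      rw [hPj] at hmul
      exact Nat.eq_of_mul_eq_mul_left (pow_pos hp.pos 2) (by rw [hmul, mul_one])
    rw [hPQ, absNorm_eq_one_iff.mp hQ, ← Ideal.one_eq_top, mul_one]
    exact hP

/-- The quotient by P has prime order p, so 1 generates it additively. For α = √(-z) this produces a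
root of X² + z modulo p. -/
theorem exists_int_sub_mem {p : ℕ} (hp : p.Prime) {P : Ideal (𝓞 K)} (hP : absNorm P = p) (α : 𝓞 K) :
    ∃ x : ℤ, α - (x : 𝓞 K) ∈ P := by
  have : Fact p.Prime := ⟨hp⟩
  have hcard : Nat.card (𝓞 K ⧸ P) = p := hP
  have hne : (1 : 𝓞 K ⧸ P) ≠ 0 := by
    intro h
    have : (1 : 𝓞 K) ∈ P := Ideal.Quotient.eq_zero_iff_mem.mp (by simpa using h)
    rw [(Ideal.eq_top_iff_one P).mpr this, absNorm_top] at hP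
    exact hp.one_lt.ne hP
  obtain ⟨x, hx⟩ := mem_zmultiples_of_prime_card hcard (g' := Ideal.Quotient.mk P α) hne
  refine ⟨x, ?_⟩
  rw [← Ideal.Quotient.eq_zero_iff_mem, map_sub, ← hx]
  simp

theorem intCast_dvd_of_mem {p : ℕ} {P : Ideal (𝓞 K)} (hP : absNorm P = p) {a : 𝓞 K} {m : ℤ}
    (ha : absNorm (span {a}) = m.natAbs) (h : a ∈ P) : (p : ℤ) ∣ m := by
  have := absNorm_dvd_absNorm_of_le ((Ideal.span_singleton_le_iff_mem P).mpr h)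
  rw [hP, ha] at this
  exact Int.natCast_dvd.mpr this

theorem sq_dvd_of_mem_span (hrank : Module.finrank ℤ (𝓞 K) = 2) {p : ℕ} {a : 𝓞 K} {m : ℤ}
    (ha : absNorm (span {a}) = m.natAbs) (h : a ∈ span {(p : 𝓞 K)}) : (p : ℤ) ^ 2 ∣ m := by
  have := intCast_dvd_of_mem (p := p ^ 2) (by rw [absNorm_span_natCast, hrank]) ha h
  exact_mod_cast this

theorem sub_mul_add_mem {z p : ℕ} {α : 𝓞 K} (hα : α ^ 2 = -(z : 𝓞 K)) {x : ℤ} (hx : (p : ℤ) ∣ x ^ 2 + z) :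
    (α - (x : 𝓞 K)) * (α + (x : 𝓞 K)) ∈ span {(p : 𝓞 K)} := by
  obtain ⟨c, hc⟩ := hx
  have hc' : (x : 𝓞 K) ^ 2 + z = p * c := by exact_mod_cast congrArg (Int.cast (R := 𝓞 K)) hc
  refine Ideal.mem_span_singleton'.mpr ⟨-(c : 𝓞 K), ?_⟩
  linear_combination hc' - hα

theorem sub_notMem_and_add_notMem {z p : ℕ} {α : 𝓞 K} (hrank : Module.finrank ℤ (𝓞 K) = 2) 
    (hN : ∀ x : ℤ, absNorm (span {α - (x : 𝓞 K)}) = (x ^ 2 + z).natAbs) {x : ℤ} (hx : ¬ (p : ℤ) ^ 2 ∣ x ^ 2 + z) :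
    α - (x : 𝓞 K) ∉ span {(p : 𝓞 K)} ∧ α + (x : 𝓞 K) ∉ span {(p : 𝓞 K)} := by
  refine ⟨fun h => hx (sq_dvd_of_mem_span hrank (hN x) h), fun h => hx ?_⟩
  have h' : α - ((-x : ℤ) : 𝓞 K) ∈ span {(p : 𝓞 K)} := by simpa using h
  simpa using sq_dvd_of_mem_span hrank (hN (-x)) h'

/-- A root `x` of `X^2 + z` modulo `p` that is not a root modulo `p^2` shows that `p` is not
inert. -/
theorem not_prime_span {z p : ℕ} {α : 𝓞 K} (hrank : Module.finrank ℤ (𝓞 K) = 2) (hα : α ^ 2 = -(z : 𝓞 K)) 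
    (hN : ∀ x : ℤ, absNorm (span {α - (x : 𝓞 K)}) = (x ^ 2 + z).natAbs) {x : ℤ} (hx : (p : ℤ) ∣ x ^ 2 + z) (hx' : ¬ (p : ℤ) ^ 2 ∣ x ^ 2 + z) :
    ¬ Prime (span {(p : 𝓞 K)}) := by
  intro hprime
  have hI := Ideal.isPrime_of_prime hprime
  obtain ⟨h1, h2⟩ := sub_notMem_and_add_notMem hrank hN hx'
  rcases hI.mem_or_mem (sub_mul_add_mem hα hx) with h | h
  · exact h1 h
  · exact h2 h

/-- Modulo p the elements α - x and α + x agree, so both P and Q contain α - x. Were they distinct,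
α - x would lie in P ∩ Q = PQ = (p), and p² would divide its norm x² + z. -/
theorem eq_of_span_eq_mul_of_dvd {z p : ℕ} {α : 𝓞 K} (hrank : Module.finrank ℤ (𝓞 K) = 2) (hα : α ^ 2 = -(z : 𝓞 K)) 
    (hN : ∀ x : ℤ, absNorm (span {α - (x : 𝓞 K)}) = (x ^ 2 + z).natAbs) {x : ℤ} (hx : (p : ℤ) ∣ x ^ 2 + z)
    (hx' : ¬ (p : ℤ) ^ 2 ∣ x ^ 2 + z) (h2x : (p : ℤ) ∣ 2 * x) {P Q : Ideal (𝓞 K)} (hP : Prime P)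
    (hQ : Prime Q) (hPQ : span {(p : 𝓞 K)} = P * Q) : P = Q := by
  obtain ⟨c, hc⟩ := h2x
  have hc' : 2 * (x : 𝓞 K) = c * p := by
    rw [mul_comm _ (p : 𝓞 K)]
    exact_mod_cast congrArg (Int.cast (R := 𝓞 K)) hc
  have aux : ∀ R : Ideal (𝓞 K), Prime R → span {(p : 𝓞 K)} ≤ R → α - (x : 𝓞 K) ∈ R := by
    intro R hR hpR
    rcases (Ideal.isPrime_of_prime hR).mem_or_mem (hpR (sub_mul_add_mem hα hx)) with h | h
    · exact h
    · have h2 : (c : 𝓞 K) * p ∈ R :=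
        R.mul_mem_left _ (hpR (Ideal.mem_span_singleton_self _))
      have : α - (x : 𝓞 K) = α + x - c * p := by linear_combination -hc'
      rw [this]
      exact R.sub_mem h h2
  have hPm := (Ideal.isPrime_of_prime hP).isMaximal hP.ne_zero
  have hQm := (Ideal.isPrime_of_prime hQ).isMaximal hQ.ne_zero
  by_contra hne
  have hmul := Ideal.mul_eq_inf_of_isCoprime (Ideal.isCoprime_of_isMaximal hne)
  have hmem : α - (x : 𝓞 K) ∈ span {(p : 𝓞 K)} := by
    have h1 := aux P hP (hPQ ▸ Ideal.mul_le_left)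
    have h2 := aux Q hQ (hPQ ▸ Ideal.mul_le_right)
    rw [hPQ, hmul]
    exact ⟨h1, h2⟩
  exact (sub_notMem_and_add_notMem hrank hN hx').1 hmem

/-- If (p) = P² and α - y ∈ P, then (p) contains (α - y)² and (α - y)(α + y), hence their difference
2y(α - y). As 2y is invertible modulo p, α - y ∈ (p), against the norm condition. -/
theorem ne_of_span_eq_mul_of_not_dvd {z p : ℕ} {α : 𝓞 K} (hrank : Module.finrank ℤ (𝓞 K) = 2) (hα : α ^ 2 = -(z : 𝓞 K)) 
    (hN : ∀ x : ℤ, absNorm (span {α - (x : 𝓞 K)}) = (x ^ 2 + z).natAbs) (hp : p.Prime) {x : ℤ} (hx : (p : ℤ) ∣ x ^ 2 + z)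
    (hx' : ¬ (p : ℤ) ^ 2 ∣ x ^ 2 + z) (h2x : ¬ (p : ℤ) ∣ 2 * x) {P Q : Ideal (𝓞 K)} (hP : Prime P)
    (hPQ : span {(p : 𝓞 K)} = P * Q) : P ≠ Q := by
  rintro rfl
  -- It suffices to treat a root `y` with `α - y ∈ P`.
  have aux : ∀ y : ℤ, (p : ℤ) ∣ y ^ 2 + z → ¬ (p : ℤ) ^ 2 ∣ y ^ 2 + z → ¬ (p : ℤ) ∣ 2 * y →
      α - (y : 𝓞 K) ∉ P := by
    intro y hy hy' h2y hmem
    have hsq : (α - (y : 𝓞 K)) * (α - (y : 𝓞 K)) ∈ span {(p : 𝓞 K)} := by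
      rw [hPQ]
      exact Ideal.mul_mem_mul hmem hmem
    have h2 : ((2 * y : ℤ) : 𝓞 K) * (α - (y : 𝓞 K)) ∈ span {(p : 𝓞 K)} := by
      have e : ((2 * y : ℤ) : 𝓞 K) * (α - (y : 𝓞 K)) =
          (α - (y : 𝓞 K)) * (α + (y : 𝓞 K)) - (α - (y : 𝓞 K)) * (α - (y : 𝓞 K)) := by
        push_cast
        ring
      rw [e]
      exact sub_mem (sub_mul_add_mem hα hy) hsq
    obtain ⟨u, v, huv⟩ : IsCoprime (p : ℤ) (2 * y) :=
      (Nat.prime_iff_prime_int.mp hp).coprime_iff_not_dvd.mpr h2y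
    have huv' : (u : 𝓞 K) * p + v * ((2 * y : ℤ) : 𝓞 K) = 1 := by
      exact_mod_cast congrArg (Int.cast (R := 𝓞 K)) huv
    have e : α - (y : 𝓞 K) = (u * (α - y)) * p + v * (((2 * y : ℤ) : 𝓞 K) * (α - (y : 𝓞 K))) := by
      linear_combination (-(α - (y : 𝓞 K))) * huv'
    refine (sub_notMem_and_add_notMem hrank hN hy').1 ?_
    rw [e]
    exact add_mem (Ideal.mul_mem_left _ _ (Ideal.mem_span_singleton_self _))
      (Ideal.mul_mem_left _ _ h2)
  have hle : span {(p : 𝓞 K)} ≤ P := hPQ ▸ Ideal.mul_le_left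
  rcases (Ideal.isPrime_of_prime hP).mem_or_mem (hle (sub_mul_add_mem hα hx)) with h | h
  · exact aux x hx hx' h2x h
  · exact aux (-x) (by simpa using hx) (by simpa using hx') (by simpa using h2x) (by simpa using h)

theorem kroneckerSym_zStar_eq_zero_iff {z p : ℕ} (hp : p.Prime) :
    kroneckerSym (zStar z) p = 0 ↔ p = 2 ∨ p ∣ z := by
  have h0 : zStar z % 4 = 0 := by unfold zStar; omega
  rw [kroneckerSym_of_mod_four_eq_zero h0]
  rcases hp.eq_two_or_odd with rfl | hodd
  · simp
  · have : Fact p.Prime := ⟨hp⟩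
    have hp2 : p ≠ 2 := by omega
    rw [if_pos hodd, ← jacobiSym.legendreSym.to_jacobiSym, legendreSym.eq_zero_iff,
      ZMod.intCast_zmod_eq_zero_iff_dvd, zStar, Int.natCast_dvd]
    have : (-4 * (z : ℤ)).natAbs = 2 ^ 2 * z := by omega
    rw [this, hp.dvd_mul]
    simp only [hp2, false_or]
    refine or_iff_right fun h => hp2 ((Nat.prime_dvd_prime_iff_eq hp Nat.prime_two).mp
      (hp.dvd_of_dvd_pow h))

theorem kroneckerSym_zStar_of_sq {z p : ℕ} (hp : p.Prime) (hodd : p % 2 = 1) (hpz : ¬ p ∣ z) :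
    kroneckerSym (zStar z) p = 1 ↔ ∃ x : ℤ, (p : ℤ) ∣ x ^ 2 + z := by
  have : Fact p.Prime := ⟨hp⟩
  have h2 : (2 : ZMod p) ≠ 0 := by
    intro h
    have := (ZMod.natCast_eq_zero_iff 2 p).mp (by exact_mod_cast h)
    have := (Nat.prime_dvd_prime_iff_eq hp Nat.prime_two).mp this
    omega
  have hz : (z : ZMod p) ≠ 0 := fun h => hpz ((ZMod.natCast_eq_zero_iff z p).mp h)
  have hne : ((zStar z : ℤ) : ZMod p) ≠ 0 := by
    rw [zStar]
    push_cast
    refine mul_ne_zero ?_ hz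
    rw [neg_ne_zero, show (4 : ZMod p) = 2 * 2 by norm_num]
    exact mul_ne_zero h2 h2
  rw [kroneckerSym_of_odd hodd, ← jacobiSym.legendreSym.to_jacobiSym, legendreSym.eq_one_iff p hne]
  constructor
  · rintro ⟨r, hr⟩
    refine ⟨(r / 2 : ZMod p).cast, ?_⟩
    rw [← ZMod.intCast_zmod_eq_zero_iff_dvd]
    push_cast
    rw [zStar] at hr
    push_cast at hr
    field_simp
    linear_combination -hr
  · rintro ⟨x, hx⟩
    rw [← ZMod.intCast_zmod_eq_zero_iff_dvd] at hx
    push_cast at hx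
    refine ⟨2 * x, ?_⟩
    rw [zStar]
    push_cast
    linear_combination (-4) * hx

/-- The condition modulo p² keeps α ± x out of (p). The divisibility of 2x tells a double root (p
ramified) from a simple one (p split). -/
theorem exists_root_of_kroneckerSym_ne_neg_one {z p : ℕ} (hz : z % 4 = 1) (hsq : Squarefree z)
    (hp : p.Prime) (h : kroneckerSym (zStar z) p = 0 ∨ kroneckerSym (zStar z) p = 1) :
    ∃ x : ℤ, (p : ℤ) ∣ x ^ 2 + z ∧ ¬ (p : ℤ) ^ 2 ∣ x ^ 2 + z ∧
      ((p : ℤ) ∣ 2 * x ↔ kroneckerSym (zStar z) p = 0) := by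
  by_cases h0 : kroneckerSym (zStar z) p = 0
  · rcases (kroneckerSym_zStar_eq_zero_iff hp).mp h0 with rfl | hpz
    -- For p = 2 the congruence z ≡ 1 (mod 4) gives 1 + z ≡ 2 (mod 4).
    · refine ⟨1, ?_, ?_, ?_⟩
      · push_cast; omega
      · push_cast; omega
      · simp [h0]
    · refine ⟨0, ?_, ?_, by simp [h0]⟩
      · simpa using Int.natCast_dvd_natCast.mpr hpz
      · intro hd
        have hd' : p * p ∣ z := by
          rw [← sq]
          exact_mod_cast (by simpa using hd : (p : ℤ) ^ 2 ∣ (z : ℤ))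
        exact hp.one_lt.ne' (Nat.isUnit_iff.mp (hsq p hd'))
  · have h1 := h.resolve_left h0
    have hnot := (kroneckerSym_zStar_eq_zero_iff (z := z) hp).not.mp h0
    push Not at hnot
    have hodd : p % 2 = 1 := hp.eq_two_or_odd.resolve_left hnot.1
    obtain ⟨x, hx⟩ := (kroneckerSym_zStar_of_sq hp hodd hnot.2).mp h1
    have hpi := Nat.prime_iff_prime_int.mp hp
    have key : ∀ y : ℤ, (p : ℤ) ∣ y ^ 2 + z → ¬ (p : ℤ) ∣ 2 * y := by
      intro y hy hd
      rcases hpi.dvd_mul.mp hd with h2 | hy'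
      · have := (Nat.prime_dvd_prime_iff_eq hp Nat.prime_two).mp (by exact_mod_cast h2)
        exact hnot.1 this
      · have : (p : ℤ) ∣ z := by
          have := dvd_sub hy (dvd_pow hy' two_ne_zero)
          simpa using this
        exact hnot.2 (by exact_mod_cast this)
    -- If x is a root even modulo p², then x + p is not: modulo p² the value changes by 2xp, and p
    -- does not divide 2x.
    by_cases hx2 : (p : ℤ) ^ 2 ∣ x ^ 2 + z
    · have hy : (p : ℤ) ∣ (x + p) ^ 2 + z := by
        have : (x + p) ^ 2 + (z : ℤ) = x ^ 2 + z + p * (2 * x + p) := by ring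
        rw [this]
        exact dvd_add hx (dvd_mul_right _ _)
      refine ⟨x + p, hy, fun hd => key x hx ?_, by simp [h0, key _ hy]⟩
      have hd2 : (p : ℤ) ^ 2 ∣ p * (2 * x) := by
        have := dvd_sub (dvd_sub hd hx2) (dvd_refl ((p : ℤ) ^ 2))
        have e : (x + p) ^ 2 + (z : ℤ) - (x ^ 2 + z) - p ^ 2 = p * (2 * x) := by ring
        rwa [e] at this
      rw [sq] at hd2
      exact (mul_dvd_mul_iff_left (by exact_mod_cast hp.ne_zero)).mp hd2
    · exact ⟨x, hx, hx2, by simp [h0, key _ hx]⟩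

theorem kroneckerSym_trichotomy (d : ℤ) (n : ℕ) :
    kroneckerSym d n = 0 ∨ kroneckerSym d n = 1 ∨ kroneckerSym d n = -1 := by
  unfold kroneckerSym
  split_ifs
  · simp
  · simp
  · have h8 : ZMod.χ₈ (d : ZMod 8) = 0 ∨ ZMod.χ₈ (d : ZMod 8) = 1 ∨ ZMod.χ₈ (d : ZMod 8) = -1 := by
      rw [ZMod.χ₈_int_eq_if_mod_eight]
      split_ifs <;> simp
    have hpow : ∀ k, ZMod.χ₈ (d : ZMod 8) ^ k = 0 ∨ ZMod.χ₈ (d : ZMod 8) ^ k = 1 ∨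
        ZMod.χ₈ (d : ZMod 8) ^ k = -1 := by
      intro k
      rcases h8 with h | h | h
      · rcases eq_or_ne k 0 with rfl | hk
        · simp
        · simp [h, hk]
      · simp [h]
      · rw [h]
        rcases neg_one_pow_eq_or ℤ k with h | h <;> simp [h]
    rcases hpow (n.factorization 2) with h | h | h <;>
    rcases jacobiSym.trichotomy d (n / 2 ^ n.factorization 2) with h' | h' | h' <;>
    rw [h, h'] <;> norm_num

end QuadraticField

/-! ### Kronecker's factorization of the L-function of a genus character -/

section GenusCoefficients

open Ideal
open scoped NumberField

variable {K : Type*} [Field K] [NumberField K]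

theorem dvd_span_intCast_iff {p : ℕ} (hp : p.Prime) {P : Ideal (𝓞 K)} (hP : Prime P)
    (hpP : (p : 𝓞 K) ∈ P) (f : ℤ) : P ∣ span {(f : 𝓞 K)} ↔ (p : ℤ) ∣ f := by
  rw [Ideal.dvd_span_singleton]
  constructor
  · intro hf
    by_contra hpf
    obtain ⟨u, v, huv⟩ := (Nat.prime_iff_prime_int.mp hp).coprime_iff_not_dvd.mpr hpf
    have h1 : (u : 𝓞 K) * p + v * f = 1 := by exact_mod_cast congrArg (Int.cast (R := 𝓞 K)) huv
    refine (Ideal.isPrime_of_prime hP).ne_top ((Ideal.eq_top_iff_one P).mpr ?_)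
    rw [← h1]
    exact add_mem (P.mul_mem_left _ hpP) (P.mul_mem_left _ hf)
  · rintro ⟨c, rfl⟩
    push_cast
    exact P.mul_mem_right _ hpP

theorem genusChar_of_mem {p : ℕ} (hp : p.Prime) {P : Ideal (𝓞 K)} (hP : Prime P)
    (hpP : (p : 𝓞 K) ∈ P) (f g : ℤ) : genusChar K f g P =
      if (p : ℤ) ∣ f then (kroneckerSym g (absNorm P) : ℂ) else kroneckerSym f (absNorm P) := by
  rw [genusChar_of_prime f g hP, genusCharPrime]
  simp only [dvd_span_intCast_iff hp hP hpP]

theorem kroneckerSym_prime_eq_zero {d : ℤ} (hd : IsDiscriminant d) {p : ℕ} (hp : p.Prime)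
    (h : (p : ℤ) ∣ d) : kroneckerSym d p = 0 := by
  refine kroneckerSym_eq_zero hd fun hc => ?_
  exact (Nat.Prime.coprime_iff_not_dvd hp).mp hc (Int.natCast_dvd.mp h)

theorem kroneckerArith_mul_prime_pow {f g : ℤ} (hf : IsDiscriminant f) (hg : IsDiscriminant g)
    {p : ℕ} (hp : p.Prime) (k : ℕ) :
    (kroneckerArith f * kroneckerArith g) (p ^ k) = ∑ i ∈ Finset.range (k + 1),
      (kroneckerSym f p : ℂ) ^ i * (kroneckerSym g p : ℂ) ^ (k - i) := by
  have h := congrArg (PowerSeries.coeff k)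
    (ArithmeticFunction.bellSeries_mul hp (kroneckerArith f) (kroneckerArith g))
  rw [ArithmeticFunction.coeff_bellSeries, PowerSeries.coeff_mul,
    Finset.Nat.sum_antidiagonal_eq_sum_range_succ_mk] at h
  rw [h]
  refine Finset.sum_congr rfl fun i _ => ?_
  simp only [ArithmeticFunction.coeff_bellSeries,
    (isCompletelyMultiplicative_kroneckerArith hf).map_pow,
    (isCompletelyMultiplicative_kroneckerArith hg).map_pow, kroneckerArith_apply _ hp.ne_zero]

theorem sum_range_mul_pow_of_eq_zero {a b : ℂ} (h : a = 0 ∨ b = 0) (k : ℕ) :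
    ∑ i ∈ Finset.range (k + 1), a ^ i * b ^ (k - i) = (a + b) ^ k := by
  rcases h with rfl | rfl
  · rw [Finset.sum_range_succ']
    simp
  · rw [Finset.sum_range_succ, Finset.sum_eq_zero]
    · simp
    · intro i hi
      rw [zero_pow (by have := Finset.mem_range.mp hi; omega), mul_zero]

/-- The sum is (a^{k+1} - (-a)^{k+1}) / (2a). This is the inert case, where χ_f(p) = -χ_g(p) = ±1
and only even powers of p are norms. -/
theorem sum_range_mul_pow_of_eq_neg {a : ℂ} (h : a ^ 2 = 1) (k : ℕ) :
    ∑ i ∈ Finset.range (k + 1), a ^ i * (-a) ^ (k - i) = if 2 ∣ k then 1 else 0 := by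
  have ha : a ≠ 0 := by
    rintro rfl
    norm_num at h
  have h2 : a - -a ≠ 0 := by
    rw [sub_neg_eq_add, ← two_mul]
    exact mul_ne_zero two_ne_zero ha
  have key := geom_sum₂_mul a (-a) (k + 1)
  rw [Nat.add_sub_cancel] at key
  refine mul_right_cancel₀ h2 (key.trans ?_)
  rcases Nat.even_or_odd' k with ⟨j, rfl | rfl⟩
  · rw [if_pos (dvd_mul_right 2 j), Odd.neg_pow ⟨j, rfl⟩, pow_succ, pow_mul, h]
    ring
  · rw [if_neg (by omega), Even.neg_pow ⟨j + 1, by ring⟩]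
    ring

/-- The product χ_f(p) χ_g(p) = χ_{z*}(p) is -1, 0 or 1 as p is inert, ramified or split. Inert: the
prime has norm p² and value χ_f(p)² = 1. Ramified: one of χ_f(p), χ_g(p) vanishes and the other
powers the sum. Split: both primes have the common value χ_f(p) = χ_g(p). -/
theorem idealCoeff_genusChar_prime_pow {z : ℕ} (hz : z % 4 = 1) (hsq : Squarefree z)
    (hK : IsQuadraticFieldOf K (zStar z)) {f g : ℤ} (hf : IsDiscriminant f)
    (hg : IsDiscriminant g) (hfg : f * g = zStar z) {p : ℕ} (hp : p.Prime) (k : ℕ) :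
    idealCoeff K (genusChar K f g) (p ^ k) = (kroneckerArith f * kroneckerArith g) (p ^ k) := by
  obtain ⟨hrank, α, hα, hN⟩ := hK.exists_sqrt (by omega)
  rw [kroneckerArith_mul_prime_pow hf hg hp]
  have hprod : kroneckerSym f p * kroneckerSym g p = kroneckerSym (zStar z) p := by
    rw [← kroneckerSym_mul_left, hfg]
  have hzero : (p : ℤ) ∣ f → kroneckerSym f p = 0 := kroneckerSym_prime_eq_zero hf hp
  have hzero' : (p : ℤ) ∣ g → kroneckerSym g p = 0 := kroneckerSym_prime_eq_zero hg hp
  rcases prime_span_or_eq_mul hrank hp with hprime | ⟨P, Q, hP, hQ, hPN, hQN, hPQ⟩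
  · have hm1 : kroneckerSym (zStar z) p = -1 := by
      by_contra hne
      have h01 : kroneckerSym (zStar z) p = 0 ∨ kroneckerSym (zStar z) p = 1 := by
        rcases kroneckerSym_trichotomy (zStar z) p with h | h | h <;> tauto
      obtain ⟨x, hx, hx', -⟩ := exists_root_of_kroneckerSym_ne_neg_one hz hsq hp h01
      exact not_prime_span hrank hα hN hx hx' hprime
    have hnorm : absNorm (span {(p : 𝓞 K)}) = p ^ 2 := by rw [absNorm_span_natCast, hrank]
    have huniq : ∀ Q : Ideal (𝓞 K), Prime Q → Q ∣ span {(p : 𝓞 K)} → Q = span {(p : 𝓞 K)} :=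
      fun Q hQ h => associated_iff_eq.mp ((hQ.dvd_prime_iff_associated hprime).mp h)
    have hpf : ¬ (p : ℤ) ∣ f := by
      intro h
      rw [hm1, hzero h] at hprod
      omega
    rw [hm1] at hprod
    have hf2 : kroneckerSym f p * kroneckerSym f p = 1 := by
      rcases kroneckerSym_trichotomy f p with h | h | h <;> simp [h] at hprod ⊢
    have hgf : kroneckerSym g p = -kroneckerSym f p := by
      linear_combination kroneckerSym f p * hprod - kroneckerSym g p * hf2
    rw [idealCoeff_prime_pow_of_unique hp two_ne_zero hnorm huniq,
      genusChar_of_mem hp hprime (Ideal.mem_span_singleton_self _), if_neg hpf, hnorm, sq,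
      kroneckerSym_mul hf, hf2, hgf]
    push_cast
    rw [sum_range_mul_pow_of_eq_neg (by rw [sq]; exact_mod_cast hf2), one_pow]
  · have huniq : ∀ R : Ideal (𝓞 K), Prime R → R ∣ span {(p : 𝓞 K)} → R = P ∨ R = Q := by
      intro R hR h
      rw [hPQ] at h
      rcases hR.dvd_or_dvd h with h | h
      · exact Or.inl (associated_iff_eq.mp ((hR.dvd_prime_iff_associated hP).mp h))
      · exact Or.inr (associated_iff_eq.mp ((hR.dvd_prime_iff_associated hQ).mp h))
    have hpP := natCast_mem_of_absNorm_eq hPN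
    have hpQ := natCast_mem_of_absNorm_eq hQN
    have h01 : kroneckerSym (zStar z) p = 0 ∨ kroneckerSym (zStar z) p = 1 := by
      by_cases h0 : kroneckerSym (zStar z) p = 0
      · exact Or.inl h0
      · right
        have hnot := (kroneckerSym_zStar_eq_zero_iff (z := z) hp).not.mp h0
        push Not at hnot
        rw [kroneckerSym_zStar_of_sq hp (hp.eq_two_or_odd.resolve_left hnot.1) hnot.2]
        obtain ⟨x, hx⟩ := exists_int_sub_mem hp hPN α
        exact ⟨x, intCast_dvd_of_mem hPN (hN x) hx⟩
    obtain ⟨x, hx, hx', h2x⟩ := exists_root_of_kroneckerSym_ne_neg_one hz hsq hp h01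
    rcases h01 with h0 | h1
    · obtain rfl := eq_of_span_eq_mul_of_dvd hrank hα hN hx hx' (h2x.mpr h0) hP hQ hPQ
      have huniq' : ∀ R : Ideal (𝓞 K), Prime R → R ∣ span {(p : 𝓞 K)} → R = P :=
        fun R hR h => (huniq R hR h).elim id id
      -- The sum expresses both branches of the definition at once: p divides fg, so the symbol not
      -- selected is zero.
      have hval : genusChar K f g P = (kroneckerSym f p : ℂ) + kroneckerSym g p := by
        rw [genusChar_of_mem hp hP hpP, hPN]
        split_ifs with h
        · rw [hzero h, Int.cast_zero, zero_add]
        · have hpg : (p : ℤ) ∣ g := by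
            have hd : (p : ℤ) ∣ f * g := by
              rw [hfg, zStar]
              rcases (kroneckerSym_zStar_eq_zero_iff hp).mp h0 with rfl | hpz
              · exact Dvd.intro (-2 * (z : ℤ)) (by push_cast; ring)
              · exact Dvd.dvd.mul_left (Int.natCast_dvd_natCast.mpr hpz) _
            exact ((Nat.prime_iff_prime_int.mp hp).dvd_or_dvd hd).resolve_left h
          rw [hzero' hpg, Int.cast_zero, add_zero]
      rw [h0] at hprod
      rw [idealCoeff_prime_pow_of_unique hp one_ne_zero (by rw [hPN, pow_one]) huniq',
        if_pos (one_dvd k), Nat.div_one, hval, sum_range_mul_pow_of_eq_zero]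
      exact_mod_cast mul_eq_zero.mp hprod
    · have hne := ne_of_span_eq_mul_of_not_dvd hrank hα hN hp hx hx'
        (by rw [h2x, h1]; exact one_ne_zero) hP hPQ
      rw [h1] at hprod
      have hpf : ¬ (p : ℤ) ∣ f := by
        intro h
        rw [hzero h] at hprod
        omega
      have hfg' : kroneckerSym f p = kroneckerSym g p := by
        rcases kroneckerSym_trichotomy f p with h | h | h <;> simp [h] at hprod ⊢ <;> omega
      rw [idealCoeff_prime_pow_of_split hp hP hQ hne hPN hQN huniq, genusChar_of_mem hp hP hpP,
        genusChar_of_mem hp hQ hpQ, if_neg hpf, if_neg hpf, hPN, hQN, hfg']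

/-- Kronecker's factorization: the coefficients of the `L`-function of the genus character
`χ_{f,g}` are those of `L(s, χ_f) L(s, χ_g)`. -/
theorem idealCoeff_genusChar {z : ℕ} (hz : z % 4 = 1) (hsq : Squarefree z)
    (hK : IsQuadraticFieldOf K (zStar z)) {f g : ℤ} (hf : IsDiscriminant f)
    (hg : IsDiscriminant g) (hfg : f * g = zStar z) {n : ℕ} (hn : n ≠ 0) :
    idealCoeff K (genusChar K f g) n = (kroneckerArith f * kroneckerArith g) n := by
  have hmul := (isCompletelyMultiplicative_kroneckerArith hf).isMultiplicative.mul
    (isCompletelyMultiplicative_kroneckerArith hg).isMultiplicative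
  induction n using Nat.recOnPrimeCoprime with
  | zero => exact absurd rfl hn
  | prime_pow p k hp => exact idealCoeff_genusChar_prime_pow hz hsq hK hf hg hfg hp k
  | coprime a b ha hb hab iha ihb =>
    rw [idealCoeff_mul_of_coprime (fun hI hJ => genusChar_mul f g hI hJ) (by omega) (by omega) hab,
      hmul.2 hab, iha (by omega), ihb (by omega)]

end GenusCoefficients

/-! ### The pole at s = 1 and the shape of the continuation -/

section MainTheorem

open Filter Topology

theorem meromorphicAt_quadLProd_two_mul (a b : ℤ) (s : ℂ) :
    MeromorphicAt (fun s => quadLProd a b (2 * s)) s :=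
  meromorphicAt_dirichletL_two_mul _ _

/-- The quotient of `L`-functions in the conclusion of the theorem. -/
noncomputable abbrev poleQuotient (Z Z' d : ℤ) (s : ℂ) : ℂ :=
  zetaDepleted d s * dirichletL (quadChar Z) s * dirichletL (quadChar Z') s *
    quadLProd (Z / d) (Z' / d) s / quadLProd Z Z' (2 * s)

theorem meromorphicAt_poleQuotient (Z Z' d : ℤ) (s : ℂ) :
    MeromorphicAt (poleQuotient Z Z' d) s :=
  ((((meromorphicAt_zetaDepleted d s).mul (meromorphicAt_dirichletL _ s)).mul
    (meromorphicAt_dirichletL _ s)).mul (meromorphicAt_dirichletL _ s)).div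
    (meromorphicAt_quadLProd_two_mul Z Z' s)

/-- Orders add: -1 from ζ^{(d)}, at most 0 from each other factor of the numerator, and 0 from the
denominator. -/
theorem hasPoleAt_poleQuotient {Z Z' d : ℤ} (hZ : Z ≠ 0) (hZ' : Z' ≠ 0) (hd : d ∣ Z)
    (hd' : d ∣ Z') : HasPoleAt (poleQuotient Z Z' d) 1 := by
  have hd0 : d ≠ 0 := by
    rintro rfl
    exact hZ (zero_dvd_iff.mp hd)
  have hq : Z / d ≠ 0 := fun h => hZ (Int.eq_zero_of_ediv_eq_zero hd h)
  have hq' : Z' / d ≠ 0 := fun h => hZ' (Int.eq_zero_of_ediv_eq_zero hd' h)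
  refine ⟨meromorphicAt_poleQuotient Z Z' d 1, ?_⟩
  have m1 := meromorphicAt_zetaDepleted d 1
  have m2 := meromorphicAt_dirichletL (quadChar Z) 1
  have m3 := meromorphicAt_dirichletL (quadChar Z') 1
  have m4 := meromorphicAt_dirichletL ((quadChar (Z / d)).mul (quadChar (Z' / d))) 1
  have m5 := meromorphicAt_quadLProd_two_mul Z Z' 1
  have e : poleQuotient Z Z' d = zetaDepleted d * dirichletL (quadChar Z) *
      dirichletL (quadChar Z') * quadLProd (Z / d) (Z' / d) /
      (fun s => quadLProd Z Z' (2 * s)) := rfl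
  rw [e, meromorphicOrderAt_div (((m1.mul m2).mul m3).mul m4) m5,
    meromorphicOrderAt_mul ((m1.mul m2).mul m3) m4, meromorphicOrderAt_mul (m1.mul m2) m3,
    meromorphicOrderAt_mul m1 m2, meromorphicOrderAt_zetaDepleted hd0,
    meromorphicOrderAt_dirichletL_two_mul (lcm_natAbs_ne_zero hZ hZ')]
  have o2 := meromorphicOrderAt_dirichletL_le (Int.natAbs_ne_zero.mpr hZ) (quadChar Z)
  have o3 := meromorphicOrderAt_dirichletL_le (Int.natAbs_ne_zero.mpr hZ') (quadChar Z')
  have o4 := meromorphicOrderAt_dirichletL_le (lcm_natAbs_ne_zero hq hq')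
    ((quadChar (Z / d)).mul (quadChar (Z' / d)))
  rw [sub_zero]
  calc _ ≤ ((-1 : ℤ) : WithTop ℤ) + 0 + 0 + 0 := by gcongr
    _ < 0 := by
      simp only [add_zero]
      exact_mod_cast (by norm_num : (-1 : ℤ) < 0)

/-- The product of four `L`-functions given by Rankin-Selberg. -/
noncomputable abbrev rankinProduct (f g f' g' : ℤ) (s : ℂ) : ℂ :=
  quadLProd f f' s * quadLProd f g' s * (quadLProd g f' s * quadLProd g g' s) /
    quadLProd (f * g) (f' * g') (2 * s)

theorem meromorphicAt_rankinProduct (f g f' g' : ℤ) (s : ℂ) :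
    MeromorphicAt (rankinProduct f g f' g') s :=
  (((meromorphicAt_dirichletL _ s).mul (meromorphicAt_dirichletL _ s)).mul
    ((meromorphicAt_dirichletL _ s).mul (meromorphicAt_dirichletL _ s))).div
    (meromorphicAt_quadLProd_two_mul _ _ s)

theorem exists_eq_one_of_hasPoleAt_rankinProduct {f g f' g' : ℤ} (hf : f ≠ 0) (hg : g ≠ 0)
    (hf' : f' ≠ 0) (hg' : g' ≠ 0) (h : HasPoleAt (rankinProduct f g f' g') 1) :
    (quadChar f).mul (quadChar f') = 1 ∨ (quadChar f).mul (quadChar g') = 1 ∨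
      (quadChar g).mul (quadChar f') = 1 ∨ (quadChar g).mul (quadChar g') = 1 := by
  by_contra! hne
  obtain ⟨h1, h2, h3, h4⟩ := hne
  refine h.2.not_ge (le_of_eq ?_)
  have m : ∀ a b : ℤ, MeromorphicAt (quadLProd a b) 1 := fun a b => meromorphicAt_dirichletL _ 1
  have e : rankinProduct f g f' g' = quadLProd f f' * quadLProd f g' *
      (quadLProd g f' * quadLProd g g') / (fun s => quadLProd (f * g) (f' * g') (2 * s)) := rfl
  rw [e, meromorphicOrderAt_div (((m _ _).mul (m _ _)).mul ((m _ _).mul (m _ _)))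
      (meromorphicAt_quadLProd_two_mul _ _ 1),
    meromorphicOrderAt_mul ((m _ _).mul (m _ _)) ((m _ _).mul (m _ _)),
    meromorphicOrderAt_mul (m _ _) (m _ _), meromorphicOrderAt_mul (m _ _) (m _ _),
    meromorphicOrderAt_dirichletL_two_mul
      (lcm_natAbs_ne_zero (mul_ne_zero hf hg) (mul_ne_zero hf' hg')),
    meromorphicOrderAt_dirichletL_of_ne (lcm_natAbs_ne_zero hf hf') h1,
    meromorphicOrderAt_dirichletL_of_ne (lcm_natAbs_ne_zero hf hg') h2,
    meromorphicOrderAt_dirichletL_of_ne (lcm_natAbs_ne_zero hg hf') h3,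
    meromorphicOrderAt_dirichletL_of_ne (lcm_natAbs_ne_zero hg hg') h4]
  simp

/-- The two characters live at different levels, lcm(|a|, |b|) and |ab|, but have the same values on
positive integers, so the comparison is made between series. -/
theorem quadLProd_mul_eq {a b : ℤ} (ha : IsDiscriminant a) (hb : IsDiscriminant b)
    (hab : IsDiscriminant (a * b)) {s : ℂ} (hs : 1 < s.re) :
    quadLProd a b s = dirichletL (quadChar (a * b)) s :=
  HasSum.unique (LSeriesHasSum_kroneckerArith_mul ha hb hs) (LSeriesHasSum_kroneckerArith hab hs)

theorem quadLProd_self {d : ℤ} (hd : IsDiscriminant d) {s : ℂ} (hs : 1 < s.re) :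
    quadLProd d d s = zetaDepleted d s := by
  have hs1 : s ≠ 1 := by
    rintro rfl
    simp at hs
  rw [zetaDepleted_eq_dirichletL hd.1 hs1, quadLProd,
    dirichletL_eq_LSeries (lcm_natAbs_ne_zero hd.1 hd.1) _ hs,
    dirichletL_eq_LSeries (Int.natAbs_ne_zero.mpr hd.1) _ hs]
  refine LSeries_congr (fun {n} _ => ?_) s
  rw [DirichletCharacter.mul_natCast]
  by_cases hu : IsUnit (n : ZMod d.natAbs)
  · rw [MulChar.one_apply hu, quadChar_natCast hd, ← Int.cast_mul]
    have hne : kroneckerSym d n ≠ 0 := by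
      intro h0
      have := (hu.map (quadChar d)).ne_zero
      rw [quadChar_natCast hd, h0] at this
      simp at this
    rcases kroneckerSym_trichotomy d n with h | h | h
    · exact absurd h hne
    · simp [h]
    · simp [h]
  · rw [MulChar.map_nonunit _ hu, MulChar.map_nonunit _ hu, mul_zero]

/-- χ_d² gives ζ^{(d)}, the mixed products χ_d χ_{g'} and χ_g χ_d merge into χ_{dg'} and χ_{dg}, and
g, g' are the quotients by d. -/
theorem rankinProduct_eq_poleQuotient {d g g' : ℤ} (hd : IsDiscriminant d)
    (hg : IsDiscriminant g) (hg' : IsDiscriminant g') (h : IsDiscriminant (d * g))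
    (h' : IsDiscriminant (d * g')) {s : ℂ} (hs : 1 < s.re) :
    rankinProduct d g d g' s = poleQuotient (d * g) (d * g') d s := by
  have hgd : IsDiscriminant (g * d) := mul_comm d g ▸ h
  rw [rankinProduct, poleQuotient, Int.mul_ediv_cancel_left _ hd.1,
    Int.mul_ediv_cancel_left _ hd.1, quadLProd_self hd hs, quadLProd_mul_eq hd hg' h' hs,
    quadLProd_mul_eq hg hd hgd hs, mul_comm g d]
  ring

theorem not_eight_dvd_of_mul_eq_zStar {z : ℕ} (hz : z % 4 = 1) {f g : ℤ}
    (h : f * g = zStar z) : ¬ (8 : ℤ) ∣ f := by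
  intro h8
  have : (8 : ℤ) ∣ zStar z := h ▸ Dvd.dvd.mul_right h8 g
  unfold zStar at this
  omega

theorem isDiscriminant_zStar {z : ℕ} (hz : z % 4 = 1) : IsDiscriminant (zStar z) := by
  unfold zStar
  exact ⟨by omega, Or.inl (by omega)⟩

/-- If one of the characters on the Rankin-Selberg side is principal, the continuation has the
shape `poleQuotient`. -/
theorem exists_eventuallyEq_poleQuotient {z z' : ℕ} (hz : z % 4 = 1) (hz' : z' % 4 = 1)
    {f g f' g' : ℤ} (hf : IsFundamentalDiscriminant f) (hg : IsFundamentalDiscriminant g)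
    (hf' : IsFundamentalDiscriminant f') (hg' : IsFundamentalDiscriminant g')
    (h : f * g = zStar z) (h' : f' * g' = zStar z') {A : ℂ → ℂ}
    (hA : MeromorphicOn A {s : ℂ | 1 / 2 < s.re})
    (hsum : ∀ s : ℂ, 1 < s.re → LSeriesHasSum (fun n => (kroneckerArith f * kroneckerArith g) n *
      (kroneckerArith f' * kroneckerArith g') n) s (A s))
    (hone : (quadChar f).mul (quadChar f') = 1) :
    ∃ d : ℤ, IsFundamentalDiscriminant d ∧ d ∣ (Int.gcd (zStar z) (zStar z') : ℤ) ∧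
      A =ᶠ[codiscreteWithin {s : ℂ | 1 / 2 < s.re}] poleQuotient (zStar z) (zStar z') d := by
  obtain rfl := eq_of_quadChar_mul_eq_one hf hf' (not_eight_dvd_of_mul_eq_zStar hz h)
    (not_eight_dvd_of_mul_eq_zStar hz' h') hone
  refine ⟨f, hf, Int.dvd_coe_gcd ⟨g, h.symm⟩ ⟨g', h'.symm⟩, ?_⟩
  have hd : IsDiscriminant (f * g) := h ▸ isDiscriminant_zStar hz
  have hd' : IsDiscriminant (f * g') := h' ▸ isDiscriminant_zStar hz'
  refine MeromorphicOn.eventuallyEq_codiscreteWithin_of_half_plane hA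
    (fun s _ => meromorphicAt_poleQuotient _ _ _ s) fun s hs => ?_
  rw [← h, ← h', ← rankinProduct_eq_poleQuotient hf.isDiscriminant hg.isDiscriminant
    hg'.isDiscriminant hd hd' hs]
  exact HasSum.unique (hsum s hs) (LSeriesHasSum_rankinSelberg hf.isDiscriminant hg.isDiscriminant
    hf.isDiscriminant hg'.isDiscriminant hd hd' hs)

theorem lemma2p5 (z₁ z₂ : ℕ)
    (hz₁ : z₁ % 4 = 1 ∧ Squarefree z₁) (hz₂ : z₂ % 4 = 1 ∧ Squarefree z₂)
    (K₁ : Type*) [Field K₁] [NumberField K₁] (hK₁ : IsQuadraticFieldOf K₁ (zStar z₁))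
    (K₂ : Type*) [Field K₂] [NumberField K₂] (hK₂ : IsQuadraticFieldOf K₂ (zStar z₂))
    (f₁ g₁ f₂ g₂ : ℤ)
    (hf₁ : IsFundamentalDiscriminant f₁) (hg₁ : IsFundamentalDiscriminant g₁)
    (hf₂ : IsFundamentalDiscriminant f₂) (hg₂ : IsFundamentalDiscriminant g₂)
    (h₁ : f₁ * g₁ = zStar z₁) (h₂ : f₂ * g₂ = zStar z₂) :
    let a : ℕ → ℂ := fun n =>
      idealCoeff K₁ (genusChar K₁ f₁ g₁) n * idealCoeff K₂ (genusChar K₂ f₂ g₂) n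
    (∃ A : ℂ → ℂ, IsMeromorphicContinuation a A) ∧
    ∀ A : ℂ → ℂ, IsMeromorphicContinuation a A →
      (HasPoleAt A 1 ↔
        ∃ d : ℤ, IsFundamentalDiscriminant d ∧ d ∣ (Int.gcd (zStar z₁) (zStar z₂) : ℤ) ∧
          A =ᶠ[Filter.codiscreteWithin {s : ℂ | 1 / 2 < s.re}] fun s =>
            zetaDepleted d s * dirichletL (quadChar (zStar z₁)) s *
                dirichletL (quadChar (zStar z₂)) s *
                dirichletL ((quadChar (zStar z₁ / d)).mul (quadChar (zStar z₂ / d))) s /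
              dirichletL ((quadChar (zStar z₁)).mul (quadChar (zStar z₂))) (2 * s)) := by
  intro a
  have hd₁ : IsDiscriminant (f₁ * g₁) := h₁ ▸ isDiscriminant_zStar hz₁.1
  have hd₂ : IsDiscriminant (f₂ * g₂) := h₂ ▸ isDiscriminant_zStar hz₂.1
  have ha : ∀ {n : ℕ}, n ≠ 0 → a n = (kroneckerArith f₁ * kroneckerArith g₁) n *
      (kroneckerArith f₂ * kroneckerArith g₂) n := by
    intro n hn
    simp only [a]
    rw [idealCoeff_genusChar hz₁.1 hz₁.2 hK₁ hf₁.isDiscriminant hg₁.isDiscriminant h₁ hn,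
      idealCoeff_genusChar hz₂.1 hz₂.2 hK₂ hf₂.isDiscriminant hg₂.isDiscriminant h₂ hn]
  have hR : ∀ s : ℂ, 1 < s.re → LSeriesHasSum a s (rankinProduct f₁ g₁ f₂ g₂ s) := fun s hs =>
    (LSeriesHasSum_congr s _ ha).mpr (LSeriesHasSum_rankinSelberg hf₁.isDiscriminant
      hg₁.isDiscriminant hf₂.isDiscriminant hg₂.isDiscriminant hd₁ hd₂ hs)
  refine ⟨⟨_, fun s _ => meromorphicAt_rankinProduct f₁ g₁ f₂ g₂ s, hR⟩, fun A hA => ⟨?_, ?_⟩⟩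
  · intro hpole
    -- An arbitrary continuation has the poles of the Rankin-Selberg quotient, since both sum the
    -- same series for Re s > 1.
    have hAR := MeromorphicOn.eventuallyEq_codiscreteWithin_of_half_plane hA.meromorphicOn
      (fun s _ => meromorphicAt_rankinProduct f₁ g₁ f₂ g₂ s)
      fun s hs => HasSum.unique (hA.hasSum s hs) (hR s hs)
    rw [hasPoleAt_congr (isOpen_lt continuous_const Complex.continuous_re)
      (by simp; norm_num) hAR] at hpole
    have hsum := fun s hs => (LSeriesHasSum_congr s (A s) ha).mp (hA.hasSum s hs)
    rcases exists_eq_one_of_hasPoleAt_rankinProduct hf₁.isDiscriminant.1 hg₁.isDiscriminant.1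
      hf₂.isDiscriminant.1 hg₂.isDiscriminant.1 hpole with h | h | h | h
    · exact exists_eventuallyEq_poleQuotient hz₁.1 hz₂.1 hf₁ hg₁ hf₂ hg₂ h₁ h₂ hA.meromorphicOn
        hsum h
    -- The remaining cases follow by exchanging f and g in one or both pairs, which leaves the
    -- convolutions unchanged.
    · refine exists_eventuallyEq_poleQuotient hz₁.1 hz₂.1 hf₁ hg₁ hg₂ hf₂ h₁
        ((mul_comm _ _).trans h₂) hA.meromorphicOn ?_ h
      rwa [mul_comm (kroneckerArith g₂)]
    · refine exists_eventuallyEq_poleQuotient hz₁.1 hz₂.1 hg₁ hf₁ hf₂ hg₂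
        ((mul_comm _ _).trans h₁) h₂ hA.meromorphicOn ?_ h
      rwa [mul_comm (kroneckerArith g₁)]
    · refine exists_eventuallyEq_poleQuotient hz₁.1 hz₂.1 hg₁ hf₁ hg₂ hf₂
        ((mul_comm _ _).trans h₁) ((mul_comm _ _).trans h₂) hA.meromorphicOn ?_ h
      rwa [mul_comm (kroneckerArith g₁), mul_comm (kroneckerArith g₂)]
  · rintro ⟨d, -, hd, hAd⟩
    rw [hasPoleAt_congr (isOpen_lt continuous_const Complex.continuous_re)
      (by simp; norm_num) hAd]
    exact hasPoleAt_poleQuotient (isDiscriminant_zStar hz₁.1).1 (isDiscriminant_zStar hz₂.1).1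
      (hd.trans (Int.gcd_dvd_left _ _)) (hd.trans (Int.gcd_dvd_right _ _))

end MainTheorem
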